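/- **Theorem 2 (Convergence result with uniformly randomized initialization).** There are positive absolute constants $b_2, C_3, C_4$ such that the following holds for every dimension $d\ge 2$. For a real random variable $Y$ let $\|Y\|_{\psi_2}=\sup_{p\ge 1}p^{-1/2}(\mathbb E|Y|^p)^{1/p}$. Let $\Sigma\in\mathbb R^{d\times d}$ be symmetric positive semidefinite with eigenvalues $\lambda_1>\lambda_2\ge\dots\ge\lambda_d\ge 0$, let $\Sigma^{1/2}$ be its symmetric positive semidefinite square root, and let $\mathbf u^*$ be a unit eigenvector of $\Sigma$ for $\lambda_1$. Let $Z$ be a random vector in $\mathbb R^d$ with $$\mathbb E[Z]=0,\qquad \mathbb E[ZZ^\top]=\mathbf I_d,\qquad \sup_{\|\mathbf v\|=1}\|\mathbf v^\top Z\|_{\psi_2}\le 1,$$ and let $X^{(1)},X^{(2)},\dots$ be independent and identically distributed with the law of $\Sigma^{1/2}Z$. Let $\mathbf u^{(0)}$ be uniformly distributed on the unit sphere of $\mathbb R^d$, independent of $(X^{(n)})_{n\ge1}$, and for $\beta>0$ let $$\mathbf u^{(n)}=\Pi\bigl\{\mathbf u^{(n-1)}+\beta X^{(n)}(X^{(n)})^\top\mathbf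 u^{(n-1)}\bigr\},\qquad \Pi\mathbf u=\|\mathbf u\|^{-1}\mathbf u,\qquad n\ge 1.$$ Put $$\widehat\beta=\frac{\lambda_1^2\,\beta}{\lambda_1-\lambda_2},\qquad N^*_{\beta,s}=\left\lceil\frac{s\log\bigl(\lambda_1^{-2}(\lambda_1-\lambda_2)\beta^{-1}\bigr)}{-\log\bigl(1-\beta(\lambda_1-\lambda_2)\bigr)}\right\rceil .$$ Then for any $\varepsilon\in(0,1/8)$, $\beta>0$, $\delta>0$ satisfying $$d\,\widehat\beta^{\,1-2\varepsilon}\le b_2\delta^2\qquad\text{and}\qquad 4d\,N^*_{\beta,2}\exp\bigl(-C_3\widehat\beta^{\,-2\varepsilon}\bigr)\le\delta$$ there is an event $\mathcal A_*$ with $\mathbb P(\mathcal A_*)\ge 1-2\delta$ such that for all integers $n\in[N^*_{\beta,2},N^*_{\beta,3}]$ $$\mathbb E\bigl[\tan^2\angle(\mathbf u^{(n)},\mathbf u^*)\,\mathbf 1_{\mathcal A_*}\bigr]\le C_4\,\delta^{-4}d^2\bigl(1-\beta(\lambda_1-\lambda_2)\bigr)^{2n}+C_4\sum_{k=2}^d\frac{\lambda_1\lambda_k+\lambda_1^2\,\widehat\beta^{\,0.5-4\varepsilon}}{\lambda_1-\lambda_k}\cdot\beta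 .$$ Here $\angle(\mathbf u,\mathbf w)=\arccos(\mathbf u^\top\mathbf w)$ for unit vectors, and $\tan^2(\pi/2)=\infty$. -/

import Mathlib

open MeasureTheory ProbabilityTheory
open scoped ENNReal

noncomputable section

namespace OnlinePCA

/-- The subgaussian norm `sup_{p ≥ 1} p^{-1/2} (E|Y|^p)^{1/p}`, with values in `[0, ∞]`. -/
def psiTwoNorm {Ω : Type*} [MeasurableSpace Ω] (P : Measure Ω) (Y : Ω → ℝ) : ℝ≥0∞ :=
  ⨆ p : {p : ℝ // 1 ≤ p},
    ENNReal.ofReal ((p : ℝ) ^ (-(1 / 2) : ℝ)) * eLpNorm Y (ENNReal.ofReal (p : ℝ)) P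

/-- `Z` is a random vector of `ℝ^d` with `E[Z] = 0`, `E[Z Zᵀ] = I_d` and
`sup_{‖v‖ = 1} ‖vᵀ Z‖_{ψ₂} ≤ 1`. (The last condition makes `Z` square integrable, so that the
two expectations are genuine integrals.) -/
structure IsIsotropicSubgaussian {d : ℕ} {Ω : Type*} [MeasurableSpace Ω] (P : Measure Ω)
    (Z : Ω → EuclideanSpace ℝ (Fin d)) : Prop where
  measurable : Measurable Z
  mean_zero : ∀ i, ∫ ω, Z ω i ∂P = 0
  second_moment : ∀ i j, ∫ ω, Z ω i * Z ω j ∂P = (1 : Matrix (Fin d) (Fin d) ℝ) i j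
  psiTwo_le_one :
    ⨆ v : Metric.sphere (0 : EuclideanSpace ℝ (Fin d)) 1,
      psiTwoNorm P (fun ω => inner ℝ (v : EuclideanSpace ℝ (Fin d)) (Z ω)) ≤ 1

/-- The action of a matrix on a vector of Euclidean space. -/
def matVec {d : ℕ} (A : Matrix (Fin d) (Fin d) ℝ) (x : EuclideanSpace ℝ (Fin d)) :
    EuclideanSpace ℝ (Fin d) :=
  WithLp.toLp 2 (A.mulVec x.ofLp)

/-- The `k`-th largest eigenvalue `λ_k` (counted with multiplicity, `k = 1, …, d`) of a
symmetric matrix; set to `0` for `k` outside `{1, …, d}`. -/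
def eigval {d : ℕ} {S : Matrix (Fin d) (Fin d) ℝ} (hS : S.IsHermitian) (k : ℕ) : ℝ :=
  if h : 1 ≤ k ∧ k ≤ d then
    hS.eigenvalues₀ ⟨k - 1, by rw [Fintype.card_fin]; omega⟩
  else 0

/-- The uniform probability distribution on the unit sphere of `ℝ^d`, as a measure on `ℝ^d`:
the normalized surface measure. -/
def uniformSphere (d : ℕ) : Measure (EuclideanSpace ℝ (Fin d)) :=
  (((volume : Measure (EuclideanSpace ℝ (Fin d))).toSphere Set.univ)⁻¹ •
    (volume : Measure (EuclideanSpace ℝ (Fin d))).toSphere).map Subtype.val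

/-- The projection `Π u = ‖u‖⁻¹ u` of a nonzero vector onto the unit sphere. -/
def proj {d : ℕ} (u : EuclideanSpace ℝ (Fin d)) : EuclideanSpace ℝ (Fin d) :=
  ‖u‖⁻¹ • u

/-- The online PCA iterates with stepsize `β`, started at `u0`, on the data stream `x`, whose
`n`-th entry (counted from zero) is the sample used in step `n + 1`:
`u⁽ⁿ⁺¹⁾ = Π {u⁽ⁿ⁾ + β x xᵀ u⁽ⁿ⁾}`. -/
def iterate {d : ℕ} (β : ℝ) (u0 : EuclideanSpace ℝ (Fin d))
    (x : ℕ → EuclideanSpace ℝ (Fin d)) : ℕ → EuclideanSpace ℝ (Fin d)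
  | 0 => u0
  | n + 1 => proj (iterate β u0 x n + (β * inner ℝ (x n) (iterate β u0 x n)) • x n)

/-- `tan² ∠(u, w)` with values in `[0, ∞]`; it is `∞` when the angle is `π / 2`. -/
def tanSq {d : ℕ} (u w : EuclideanSpace ℝ (Fin d)) : ℝ≥0∞ :=
  ENNReal.ofReal (Real.sin (InnerProductGeometry.angle u w) ^ 2) /
    ENNReal.ofReal (Real.cos (InnerProductGeometry.angle u w) ^ 2)

/-- The rescaled stepsize `λ₁² (λ₁ - λ₂)⁻¹ β`. -/
def betaHat (lam1 lam2 β : ℝ) : ℝ :=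
  lam1 ^ 2 * (lam1 - lam2)⁻¹ * β

/-- The rescaled time
`⌈ s log(λ₁⁻² (λ₁ - λ₂) β⁻¹) / (- log(1 - β (λ₁ - λ₂))) ⌉`. -/
def rescaledTime (lam1 lam2 β s : ℝ) : ℕ :=
  ⌈s * Real.log ((lam1 ^ 2)⁻¹ * (lam1 - lam2) * β⁻¹) /
    (-Real.log (1 - β * (lam1 - lam2)))⌉₊

end OnlinePCA

end

/-! Normalization commutes with the linear update, so `iterate` is a positive multiple of the linear
recursion `linIter` as long as the latter is nonzero, and tan² is the energy of the nonleading
coordinates divided by the squared leading one. The factor c = (1 + βλ₁)⁻¹ makes the leading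
coordinate a martingale. Each other coordinate has a second moment contracting at rate about 2β(λ₁ -
λₖ), with noise of size β²λ₁λₖ times the total energy. Solving this coupled linear recursion
(`coord_le_of_recursion`) gives a geometric transient plus a stationary level 64βλ₁λₖ/(λ₁ - λₖ),
which is the main term of the theorem.

To divide by the leading coordinate, keep it within half of its starting value t. All moments are
weighted by t⁻² on the event `stable`, and a Kolmogorov-type maximal inequality
(`IsLinProcess.measure_goodStart_diff_stable_le`) bounds the probability of leaving that event.
Write B for `betaHat`. The failure probability is of order β²λ₁²N + BL, where L bounds the initial
ratio of energies. The first part is at most a multiple of √B, hence of δ.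

A uniform start only has L of order d/δ², so BL would be bounded by a constant and not by δ. Hence a
burn-in phase of length `rescaledTime` at 3/5, analysed without weights: the nonleading energy falls
to order dB (`IsLinProcess.sum_moment_one_le`), while the leading coordinate is still of size at
least δ/√d up to a constant. For the latter, freeze the data: ⟨e, Mu⟩ = ⟨Mᵀe, u⟩, and ‖Mᵀe‖ ≥ ⟨e,
Me⟩ ≥ 1/2 with high probability, by the maximal inequality for the recursion started at e.
Anticoncentration on the sphere (`uniformSphere_slab_le`) then applies. Markov's inequality gives a
start with L = δ/(1024B).

From there to any time n in the window, the transient is at most B^{3/2}, which the k = 2 summand of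
the λ₁²B^{0.5-4ε} term absorbs. -/

noncomputable section

namespace OnlinePCA

local notation "𝔼" d => EuclideanSpace ℝ (Fin d)

/-! ### Deterministic coupled recursions -/

section Recursion

variable {ι : Type*} {s : Finset ι} {h : ℕ → ι → ℝ≥0∞} {p : ℕ → ℝ≥0∞} {ρ γ E D : ι → ℝ} {r L : ℝ}

/-- If every coordinate of `h n` is bounded by `E k * r ^ n + D k`, so is the sum. -/
lemma sum_le_of_coord_le (hr : 0 ≤ r) (hE : ∀ k ∈ s, 0 ≤ E k) (hD : ∀ k ∈ s, 0 ≤ D k)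
    {g : ι → ℝ≥0∞} {n : ℕ} (hg : ∀ k ∈ s, g k ≤ ENNReal.ofReal (E k * r ^ n + D k)) :
    ∑ k ∈ s, g k ≤ ENNReal.ofReal ((∑ k ∈ s, E k) * r ^ n + ∑ k ∈ s, D k) := by
  calc ∑ k ∈ s, g k ≤ ∑ k ∈ s, ENNReal.ofReal (E k * r ^ n + D k) := Finset.sum_le_sum hg
    _ = ENNReal.ofReal (∑ k ∈ s, (E k * r ^ n + D k)) := by
      rw [ENNReal.ofReal_sum_of_nonneg]
      intro k hk
      have := hE k hk
      have := hD k hk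
      positivity
    _ = _ := by rw [Finset.sum_add_distrib, Finset.sum_mul]

/-- A linear recursion of nonnegative sequences, coupled through their sum, stays below a
geometrically decaying part plus a stationary part. -/
lemma coord_le_of_recursion (hr : 0 ≤ r) (hE : ∀ k ∈ s, 0 ≤ E k) (hD : ∀ k ∈ s, 0 ≤ D k)
    (hρ : ∀ k ∈ s, 0 ≤ ρ k) (hγ : ∀ k ∈ s, 0 ≤ γ k) (hL : 0 ≤ L)
    (hsE : ∑ k ∈ s, E k ≤ 2 * L) (hsD : ∑ k ∈ s, D k ≤ 1)
    (hEr : ∀ k ∈ s, ρ k * E k + γ k * (2 * L) ≤ r * E k)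
    (hDr : ∀ k ∈ s, ρ k * D k + 4 * γ k ≤ D k)
    (h0 : ∀ k ∈ s, h 0 k ≤ ENNReal.ofReal (E k))
    (hrec : ∀ n, ∀ k ∈ s, h (n + 1) k ≤
      ENNReal.ofReal (ρ k) * h n k + ENNReal.ofReal (γ k) * (p n + ∑ l ∈ s, h n l))
    {n : ℕ} (hp : ∀ m < n, p m ≤ ENNReal.ofReal 3) :
    ∀ k ∈ s, h n k ≤ ENNReal.ofReal (E k * r ^ n + D k) := by
  induction n with
  | zero =>
    intro k hk
    refine (h0 k hk).trans (ENNReal.ofReal_le_ofReal ?_)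
    simpa using hD k hk
  | succ n ih =>
    have ih' := ih fun m hm => hp m (by omega)
    intro k hk
    have hrn : 0 ≤ r ^ n := pow_nonneg hr n
    have hEk := hE k hk
    have hDk := hD k hk
    have hρk := hρ k hk
    have hγk := hγ k hk
    -- The 4 is 3 for the leading coordinate `p` plus 1 for the total stationary level.
    have hsum : p n + ∑ l ∈ s, h n l ≤ ENNReal.ofReal (4 + 2 * L * r ^ n) := by
      have h1 := sum_le_of_coord_le hr hE hD ih'
      have h2 : (∑ k ∈ s, E k) * r ^ n + ∑ k ∈ s, D k ≤ 2 * L * r ^ n + 1 :=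
        add_le_add (mul_le_mul_of_nonneg_right hsE hrn) hsD
      calc p n + ∑ l ∈ s, h n l
          ≤ ENNReal.ofReal 3 + ENNReal.ofReal (2 * L * r ^ n + 1) :=
            add_le_add (hp n (by omega)) (h1.trans (ENNReal.ofReal_le_ofReal h2))
        _ = _ := by
          rw [← ENNReal.ofReal_add (by norm_num) (by positivity)]
          congr 1; ring
    calc h (n + 1) k
        ≤ ENNReal.ofReal (ρ k) * ENNReal.ofReal (E k * r ^ n + D k)
          + ENNReal.ofReal (γ k) * ENNReal.ofReal (4 + 2 * L * r ^ n) :=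
          (hrec n k hk).trans (add_le_add (mul_le_mul_right (ih' k hk) _)
            (mul_le_mul_right hsum _))
      _ = ENNReal.ofReal (ρ k * (E k * r ^ n + D k) + γ k * (4 + 2 * L * r ^ n)) := by
          rw [← ENNReal.ofReal_mul hρk, ← ENNReal.ofReal_mul hγk, ← ENNReal.ofReal_add]
          · positivity
          · positivity
      _ ≤ _ := by
          apply ENNReal.ofReal_le_ofReal
          have h1 := mul_le_mul_of_nonneg_right (hEr k hk) hrn
          have h2 := hDr k hk
          rw [pow_succ]
          nlinarith

/-- Summing the increments of a sequence driven by the solution of the recursion. -/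
lemma accum_le (hr : 0 ≤ r) (hr1 : r < 1) (hL : 0 ≤ L) {c : ℝ} (hc : 0 ≤ c) {q : ℕ → ℝ≥0∞}
    {t : ℕ → ℝ≥0∞} {q0 : ℝ} (hq0 : 0 ≤ q0) (hq : q 0 ≤ ENNReal.ofReal q0)
    (hrec : ∀ n, q (n + 1) ≤ q n + ENNReal.ofReal c * t n) {n : ℕ}
    (ht : ∀ m < n, t m ≤ ENNReal.ofReal (4 + 2 * L * r ^ m)) :
    q n ≤ ENNReal.ofReal (q0 + c * (4 * n + 2 * L / (1 - r))) := by
  have key : q n ≤ ENNReal.ofReal (q0 + c * (4 * n + 2 * L * ∑ i ∈ Finset.range n, r ^ i)) := by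
    induction n with
    | zero => simpa using hq
    | succ n ih =>
      have hs : 0 ≤ ∑ i ∈ Finset.range n, r ^ i := Finset.sum_nonneg fun i _ => pow_nonneg hr i
      have hrn := pow_nonneg hr n
      calc q (n + 1) ≤ _ := (hrec n).trans (add_le_add (ih fun m hm => ht m (by omega))
            (mul_le_mul_right (ht n (by omega)) _))
        _ = _ := by
          rw [← ENNReal.ofReal_mul hc, ← ENNReal.ofReal_add (by positivity) (by positivity)]
          congr 1
          rw [Finset.sum_range_succ]
          push_cast
          ring
  refine key.trans (ENNReal.ofReal_le_ofReal ?_)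
  have hg : ∑ i ∈ Finset.range n, r ^ i ≤ (1 - r)⁻¹ := by
    rw [geom_sum_eq hr1.ne, ← neg_div_neg_eq, inv_eq_one_div]
    have : 0 ≤ r ^ n := pow_nonneg hr n
    have : 0 < 1 - r := by linarith
    rw [show -(r - 1) = 1 - r by ring]
    gcongr
    linarith
  have : 2 * L * ∑ i ∈ Finset.range n, r ^ i ≤ 2 * L / (1 - r) := by
    rw [div_eq_mul_inv]; gcongr
  gcongr

end Recursion

variable {d : ℕ}

/-- Second moments and a fourth moment bound for a law on `ℝ^d` whose covariance is diagonal in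
the basis `b`, with variances `Λ`. -/
structure HasMoments (μ : Measure (𝔼 d)) (b : OrthonormalBasis (Fin d) ℝ (𝔼 d))
    (Λ : Fin d → ℝ) : Prop where
  integrable_mul : ∀ k v, Integrable (fun z => inner ℝ (b k) z * inner ℝ z v) μ
  integral_mul : ∀ k v, ∫ z, inner ℝ (b k) z * inner ℝ z v ∂μ = Λ k * inner ℝ (b k) v
  integrable_sq : ∀ k v, Integrable (fun z => (inner ℝ (b k) z * inner ℝ z v) ^ 2) μ
  integral_sq_le : ∀ k v, ∫ z, (inner ℝ (b k) z * inner ℝ z v) ^ 2 ∂μ ≤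
    16 * Λ k * ∑ j, Λ j * inner ℝ (b j) v ^ 2

/-- One step of the rescaled linear recursion underlying online PCA. -/
def linStep (c β : ℝ) (x v : 𝔼 d) : 𝔼 d :=
  c • (v + (β * inner ℝ x v) • x)

lemma inner_linStep (c β : ℝ) (e x v : 𝔼 d) :
    inner ℝ e (linStep c β x v) = c * (inner ℝ e v + β * (inner ℝ e x * inner ℝ x v)) := by
  simp only [linStep, inner_smul_right, inner_add_right]
  ring

lemma measurable_linStep (c β : ℝ) :
    Measurable fun q : (𝔼 d) × (𝔼 d) => linStep c β q.1 q.2 := by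
  unfold linStep
  fun_prop

lemma linStep_add (c β : ℝ) (x v w : 𝔼 d) :
    linStep c β x (v + w) = linStep c β x v + linStep c β x w := by
  simp only [linStep, inner_add_right, mul_add, add_smul, smul_add]
  abel

lemma linStep_smul (c β t : ℝ) (x v : 𝔼 d) :
    linStep c β x (t • v) = t • linStep c β x v := by
  simp only [linStep, inner_smul_right, smul_add, smul_smul]
  congr 2 <;> ring

/-! ### Moments after one update -/

section OneStep

variable {μ : Measure (𝔼 d)} [IsProbabilityMeasure μ] {b : OrthonormalBasis (Fin d) ℝ (𝔼 d)}
  {Λ : Fin d → ℝ}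

/-- Every one-step estimate is the mean square of an affine function of the product of two
projections of the sample. Stating it with `∫⁻` avoids integrability questions for the iterates
later on. -/
lemma HasMoments.lintegral_affine_sq (hμ : HasMoments μ b Λ) (k : Fin d) (v : 𝔼 d) (α γ : ℝ) :
    ∫⁻ z, ENNReal.ofReal ((α + γ * (inner ℝ (b k) z * inner ℝ z v)) ^ 2) ∂μ ≤
      ENNReal.ofReal (α ^ 2 + 2 * α * γ * (Λ k * inner ℝ (b k) v)
        + γ ^ 2 * (16 * Λ k * ∑ j, Λ j * inner ℝ (b j) v ^ 2)) := by
  have i1 := hμ.integrable_mul k v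
  have i2 := hμ.integrable_sq k v
  have i3 : Integrable (fun z => 2 * α * γ * (inner ℝ (b k) z * inner ℝ z v)) μ :=
    i1.const_mul _
  have i4 : Integrable (fun z => γ ^ 2 * (inner ℝ (b k) z * inner ℝ z v) ^ 2) μ :=
    i2.const_mul _
  have e : (fun z => (α + γ * (inner ℝ (b k) z * inner ℝ z v)) ^ 2) =
      fun z => (α ^ 2 + 2 * α * γ * (inner ℝ (b k) z * inner ℝ z v))
        + γ ^ 2 * (inner ℝ (b k) z * inner ℝ z v) ^ 2 := by
    funext z; ring
  have i5 : Integrable (fun z => α ^ 2 + 2 * α * γ * (inner ℝ (b k) z * inner ℝ z v)) μ :=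
    (integrable_const _).add i3
  rw [← ofReal_integral_eq_lintegral_ofReal (by rw [e]; exact i5.add i4)
    (Filter.Eventually.of_forall fun z => sq_nonneg _), e, integral_add i5 i4,
    integral_add (integrable_const _) i3, integral_const_mul, integral_const_mul,
    hμ.integral_mul]
  apply ENNReal.ofReal_le_ofReal
  have := mul_le_mul_of_nonneg_left (hμ.integral_sq_le k v) (sq_nonneg γ)
  simp only [integral_const, probReal_univ, smul_eq_mul, one_mul]
  linarith

/-- Expected squared coordinate after one step. -/
lemma HasMoments.lintegral_linStep_sq (hμ : HasMoments μ b Λ) (k : Fin d) (v : 𝔼 d) (c β : ℝ) :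
    ∫⁻ z, ENNReal.ofReal (inner ℝ (b k) (linStep c β z v) ^ 2) ∂μ ≤
      ENNReal.ofReal (c ^ 2 * ((1 + 2 * β * Λ k) * inner ℝ (b k) v ^ 2
        + β ^ 2 * (16 * Λ k * ∑ j, Λ j * inner ℝ (b j) v ^ 2))) := by
  have := hμ.lintegral_affine_sq k v (c * inner ℝ (b k) v) (c * β)
  convert this using 4
  · rw [inner_linStep]; ring
  · ring

/-- Expected squared deviation of the leading coordinate after one step, in the normalization
that makes it a martingale. -/
lemma HasMoments.lintegral_linStep_sub_sq (hμ : HasMoments μ b Λ) (k : Fin d) (v : 𝔼 d)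
    {c β : ℝ} (hc : c * (1 + β * Λ k) = 1) (t : ℝ) :
    ∫⁻ z, ENNReal.ofReal ((inner ℝ (b k) (linStep c β z v) - t) ^ 2) ∂μ ≤
      ENNReal.ofReal ((inner ℝ (b k) v - t) ^ 2
        + c ^ 2 * (β ^ 2 * (16 * Λ k * ∑ j, Λ j * inner ℝ (b j) v ^ 2))) := by
  have := hμ.lintegral_affine_sq k v (c * inner ℝ (b k) v - t) (c * β)
  refine (lintegral_mono fun z => ?_).trans (this.trans (ENNReal.ofReal_le_ofReal ?_))
  -- The mean of the updated coordinate is its old value, so the mean square about `t` splits as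
  -- below; the squared mean of the increment is then dropped by sign.
  · apply le_of_eq
    congr 2
    rw [inner_linStep]; ring
  · set a := inner ℝ (b k) v
    have h1 : (a - t) ^ 2 = (c * a - t) ^ 2 + 2 * (c * a - t) * (c * β) * (Λ k * a)
        + (c * β * Λ k * a) ^ 2 := by
      have : a - t = c * a - t + c * β * Λ k * a := by linear_combination -a * hc
      rw [this]; ring
    rw [h1]
    nlinarith [sq_nonneg (c * β * Λ k * a)]

end OneStep

/-- Integration over an independent sample. -/
lemma lintegral_comp_indep {Ω 𝓨 𝓩 : Type*} [MeasurableSpace Ω] [MeasurableSpace 𝓨]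
    [MeasurableSpace 𝓩] {P : Measure Ω} [IsProbabilityMeasure P] {Y : Ω → 𝓨} {X : Ω → 𝓩}
    (hY : Measurable Y) (hX : Measurable X) (hind : IndepFun Y X P) {f : 𝓨 × 𝓩 → ℝ≥0∞}
    (hf : Measurable f) :
    ∫⁻ ω, f (Y ω, X ω) ∂P = ∫⁻ ω, ∫⁻ x, f (Y ω, x) ∂(P.map X) ∂P := by
  have hmap := (indepFun_iff_map_prod_eq_prod_map_map hY.aemeasurable hX.aemeasurable).1 hind
  have := Measure.isProbabilityMeasure_map (μ := P) hX.aemeasurable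
  rw [← lintegral_map (f := f) (g := fun ω => (Y ω, X ω)) hf (hY.prodMk hX), hmap,
    lintegral_prod _ hf.aemeasurable, lintegral_map hf.lintegral_prod_right' hY]

/-- The rescaled linear recursion driven by samples `X n` of law `μ`, each independent of the
past `F n`. -/
structure IsLinProcess {Ω : Type*} [mΩ : MeasurableSpace Ω] (P : Measure Ω) (μ : Measure (𝔼 d))
    (c β : ℝ) (F : ℕ → MeasurableSpace Ω) (X v : ℕ → Ω → 𝔼 d) : Prop where
  mono : Monotone F
  le : ∀ n, F n ≤ mΩ
  measurable_start : Measurable[F 0] (v 0)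
  measurable_sample : ∀ n, Measurable[F (n + 1)] (X n)
  indep : ∀ n, Indep (F n) (MeasurableSpace.comap (X n) inferInstance) P
  law : ∀ n, P.map (X n) = μ
  step : ∀ n ω, v (n + 1) ω = linStep c β (X n ω) (v n ω)

/-! ### One-step inequalities along the process -/

section Dynamics

variable {Ω : Type*} [mΩ : MeasurableSpace Ω] {P : Measure Ω}
  {μ : Measure (𝔼 d)} {c β : ℝ} {F : ℕ → MeasurableSpace Ω} {X v : ℕ → Ω → 𝔼 d}
  {b : OrthonormalBasis (Fin d) ℝ (𝔼 d)} {Λ : Fin d → ℝ}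

/-- The Markov property in use: after the burn-in the process is again of the same kind, with its
current state as the new start. -/
lemma IsLinProcess.shift (h : IsLinProcess P μ c β F X v) (m : ℕ) :
    IsLinProcess P μ c β (fun n => F (m + n)) (fun n => X (m + n)) (fun n => v (m + n)) where
  mono := fun i j hij => h.mono (by omega)
  le := fun n => h.le _
  measurable_start := by
    have key : ∀ n, Measurable[F n] (v n) := by
      intro n
      induction n with
      | zero => exact h.measurable_start
      | succ n ih =>
        have : v (n + 1) = fun ω => linStep c β (X n ω) (v n ω) := funext (h.step n)
        rw [this]
        exact (measurable_linStep c β).comp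
          ((h.measurable_sample n).prodMk (ih.mono (h.mono n.le_succ) le_rfl))
    exact key m
  measurable_sample := fun n => h.measurable_sample (m + n)
  indep := fun n => h.indep _
  law := fun n => h.law _
  step := fun n => h.step (m + n)

lemma IsLinProcess.measurable_past (h : IsLinProcess P μ c β F X v) (n : ℕ) :
    Measurable[F n] (v n) := by
  have := (h.shift n).measurable_start
  simpa using this

lemma IsLinProcess.measurable (h : IsLinProcess P μ c β F X v) (n : ℕ) : Measurable (v n) :=
  (h.measurable_past n).mono (h.le n) le_rfl

/-- The weighted second moment of the `k`-th coordinate. -/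
def moment (P : Measure Ω) (b : OrthonormalBasis (Fin d) ℝ (𝔼 d)) (w : Ω → ℝ≥0∞)
    (v : Ω → 𝔼 d) (k : Fin d) : ℝ≥0∞ :=
  ∫⁻ ω, w ω * ENNReal.ofReal (inner ℝ (b k) (v ω) ^ 2) ∂P

lemma lintegral_weighted_quadratic {w : Ω → ℝ≥0∞} (hw : Measurable w) {V : Ω → 𝔼 d}
    (hV : Measurable V) (hΛ : ∀ k, 0 ≤ Λ k) {Λ₀ : ℝ} (hΛ₀ : ∀ k, Λ k ≤ Λ₀) :
    ∫⁻ ω, w ω * ENNReal.ofReal (∑ j, Λ j * inner ℝ (b j) (V ω) ^ 2) ∂P ≤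
      ENNReal.ofReal Λ₀ * ∑ j, moment P b w V j := by
  unfold moment
  rw [← lintegral_finsetSum]
  swap
  · intro j _; fun_prop
  rw [← lintegral_const_mul _ (by fun_prop)]
  refine lintegral_mono fun ω => ?_
  rw [← Finset.mul_sum, mul_left_comm]
  gcongr
  rw [← ENNReal.ofReal_sum_of_nonneg (fun _ _ => sq_nonneg _)]
  by_cases hd : Nonempty (Fin d)
  · have hΛ₀' : 0 ≤ Λ₀ := (hΛ hd.some).trans (hΛ₀ _)
    rw [← ENNReal.ofReal_mul hΛ₀']
    apply ENNReal.ofReal_le_ofReal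
    rw [Finset.mul_sum]
    gcongr
    exact hΛ₀ _
  · rw [not_nonempty_iff] at hd
    simp

variable [IsProbabilityMeasure P]

/-- The new sample is integrated out with all past quantities frozen; this replaces conditional
expectations. -/
lemma IsLinProcess.lintegral_step (h : IsLinProcess P μ c β F X v) (n : ℕ) {𝓨 : Type*}
    [MeasurableSpace 𝓨] {Y : Ω → 𝓨} (hY : Measurable[F n] Y) {f : 𝓨 × (𝔼 d) → ℝ≥0∞}
    (hf : Measurable f) :
    ∫⁻ ω, f (Y ω, X n ω) ∂P = ∫⁻ ω, ∫⁻ x, f (Y ω, x) ∂μ ∂P := by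
  rw [← h.law n]
  refine lintegral_comp_indep (hY.mono (h.le n) le_rfl)
    ((h.measurable_sample n).mono (h.le _) le_rfl) ?_ hf
  exact indep_of_indep_of_le_left (h.indep n) hY.comap_le

lemma IsLinProcess.isProbabilityMeasure (h : IsLinProcess P μ c β F X v) :
    IsProbabilityMeasure μ := by
  rw [← h.law 0]
  exact Measure.isProbabilityMeasure_map ((h.measurable_sample 0).mono (h.le _) le_rfl).aemeasurable

/-- The noise in coordinate `k` has variance proportional to `Λ k` times a quadratic form in the
whole state, so the recursion is coupled through the total energy. The factor `Λ k` is kept because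
it shapes the stationary level. -/
lemma IsLinProcess.moment_succ_le (h : IsLinProcess P μ c β F X v) (hμ : HasMoments μ b Λ)
    (hΛ : ∀ k, 0 ≤ Λ k) {Λ₀ : ℝ} (hΛ₀ : ∀ k, Λ k ≤ Λ₀) (hβ : 0 ≤ β) (hc : 0 ≤ c) (hc1 : c ≤ 1)
    (n : ℕ) {w : Ω → ℝ≥0∞} (hw : Measurable[F n] w) (k : Fin d) :
    moment P b w (v (n + 1)) k ≤
      ENNReal.ofReal (c ^ 2 * (1 + 2 * β * Λ k)) * moment P b w (v n) k
        + ENNReal.ofReal (16 * β ^ 2 * Λ k * Λ₀) * ∑ j, moment P b w (v n) j := by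
  have hprob := h.isProbabilityMeasure
  have hw' : Measurable w := hw.mono (h.le n) le_rfl
  have hv' := h.measurable n
  have hΛk := hΛ k
  have hc2 : c ^ 2 ≤ 1 := pow_le_one₀ hc hc1
  have e := h.lintegral_step n (Y := fun ω => (w ω, v n ω)) (hw.prodMk (h.measurable_past n))
    (f := fun q => q.1.1 * ENNReal.ofReal (inner ℝ (b k) (linStep c β q.2 q.1.2) ^ 2)) (by
      have : Measurable fun q : (ℝ≥0∞ × (𝔼 d)) × (𝔼 d) => linStep c β q.2 q.1.2 :=
        (measurable_linStep c β).comp (measurable_snd.prodMk (measurable_snd.comp measurable_fst))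
      fun_prop)
  calc moment P b w (v (n + 1)) k
      = ∫⁻ ω, ∫⁻ x, w ω * ENNReal.ofReal (inner ℝ (b k) (linStep c β x (v n ω)) ^ 2) ∂μ ∂P := by
        rw [← e]; unfold moment; simp only [h.step]
    _ ≤ ∫⁻ ω, (ENNReal.ofReal (c ^ 2 * (1 + 2 * β * Λ k))
          * (w ω * ENNReal.ofReal (inner ℝ (b k) (v n ω) ^ 2))
          + ENNReal.ofReal (16 * β ^ 2 * Λ k)
            * (w ω * ENNReal.ofReal (∑ j, Λ j * inner ℝ (b j) (v n ω) ^ 2))) ∂P := by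
        refine lintegral_mono fun ω => ?_
        have hQ : 0 ≤ ∑ j, Λ j * inner ℝ (b j) (v n ω) ^ 2 :=
          Finset.sum_nonneg fun j _ => mul_nonneg (hΛ j) (sq_nonneg _)
        rw [lintegral_const_mul _ (by unfold linStep; fun_prop), mul_left_comm, mul_left_comm _ (w ω),
          ← mul_add]
        gcongr
        refine (hμ.lintegral_linStep_sq k (v n ω) c β).trans ?_
        rw [← ENNReal.ofReal_mul (by positivity), ← ENNReal.ofReal_mul (by positivity),
          ← ENNReal.ofReal_add (by positivity) (by positivity)]
        apply ENNReal.ofReal_le_ofReal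
        have : c ^ 2 * (β ^ 2 * (16 * Λ k * ∑ j, Λ j * inner ℝ (b j) (v n ω) ^ 2)) ≤
            1 * (β ^ 2 * (16 * Λ k * ∑ j, Λ j * inner ℝ (b j) (v n ω) ^ 2)) := by
          gcongr
        linarith
    _ = ENNReal.ofReal (c ^ 2 * (1 + 2 * β * Λ k)) * moment P b w (v n) k
        + ENNReal.ofReal (16 * β ^ 2 * Λ k)
          * ∫⁻ ω, w ω * ENNReal.ofReal (∑ j, Λ j * inner ℝ (b j) (v n ω) ^ 2) ∂P := by
        rw [lintegral_add_left (by fun_prop), lintegral_const_mul _ (by fun_prop),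
          lintegral_const_mul _ (by fun_prop)]
        rfl
    _ ≤ _ := by
        rw [ENNReal.ofReal_mul (p := 16 * β ^ 2 * Λ k) (by positivity), mul_assoc (ENNReal.ofReal _)]
        exact add_le_add le_rfl
          (mul_le_mul_right (lintegral_weighted_quadratic hw' hv' hΛ hΛ₀) _)

/-- The martingale increment is orthogonal to the past, so the deviation grows only by the
increment's variance. It serves with t the initial coordinate for stability and with t = 0 for plain
second moments. -/
lemma IsLinProcess.lintegral_deviation_succ_le (h : IsLinProcess P μ c β F X v)
    (hμ : HasMoments μ b Λ) (hΛ : ∀ k, 0 ≤ Λ k) {i₀ : Fin d} (hΛ₀ : ∀ k, Λ k ≤ Λ i₀)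
    (hβ : 0 ≤ β) (hc : 0 ≤ c) (hc1 : c * (1 + β * Λ i₀) = 1)
    (n : ℕ) {w : Ω → ℝ≥0∞} (hw : Measurable[F n] w) {t : Ω → ℝ} (ht : Measurable[F n] t) :
    ∫⁻ ω, w ω * ENNReal.ofReal ((inner ℝ (b i₀) (v (n + 1) ω) - t ω) ^ 2) ∂P ≤
      ∫⁻ ω, w ω * ENNReal.ofReal ((inner ℝ (b i₀) (v n ω) - t ω) ^ 2) ∂P
        + ENNReal.ofReal (16 * (β ^ 2 * Λ i₀ ^ 2)) * ∑ j, moment P b w (v n) j := by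
  have hprob := h.isProbabilityMeasure
  have hw' : Measurable w := hw.mono (h.le n) le_rfl
  have ht' : Measurable t := ht.mono (h.le n) le_rfl
  have hv' := h.measurable n
  have hΛk := hΛ i₀
  have hc2 : c ^ 2 ≤ 1 := pow_le_one₀ hc (by nlinarith [mul_nonneg hc (mul_nonneg hβ hΛk)])
  have e := h.lintegral_step n (Y := fun ω => (w ω, t ω, v n ω))
    (hw.prodMk (ht.prodMk (h.measurable_past n)))
    (f := fun q => q.1.1 *
      ENNReal.ofReal ((inner ℝ (b i₀) (linStep c β q.2 q.1.2.2) - q.1.2.1) ^ 2)) (by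
      have : Measurable fun q : (ℝ≥0∞ × ℝ × (𝔼 d)) × (𝔼 d) => linStep c β q.2 q.1.2.2 :=
        (measurable_linStep c β).comp (measurable_snd.prodMk
          (measurable_snd.comp (measurable_snd.comp measurable_fst)))
      fun_prop)
  calc _ = ∫⁻ ω, ∫⁻ x, w ω *
          ENNReal.ofReal ((inner ℝ (b i₀) (linStep c β x (v n ω)) - t ω) ^ 2) ∂μ ∂P := by
        rw [← e]; simp only [h.step]
    _ ≤ ∫⁻ ω, (w ω * ENNReal.ofReal ((inner ℝ (b i₀) (v n ω) - t ω) ^ 2)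
          + ENNReal.ofReal (16 * β ^ 2 * Λ i₀)
            * (w ω * ENNReal.ofReal (∑ j, Λ j * inner ℝ (b j) (v n ω) ^ 2))) ∂P := by
        refine lintegral_mono fun ω => ?_
        have hQ : 0 ≤ ∑ j, Λ j * inner ℝ (b j) (v n ω) ^ 2 :=
          Finset.sum_nonneg fun j _ => mul_nonneg (hΛ j) (sq_nonneg _)
        rw [lintegral_const_mul _ (by unfold linStep; fun_prop), mul_left_comm _ (w ω), ← mul_add]
        gcongr
        refine (hμ.lintegral_linStep_sub_sq i₀ (v n ω) hc1 (t ω)).trans ?_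
        rw [← ENNReal.ofReal_mul (by positivity),
          ← ENNReal.ofReal_add (by positivity) (by positivity)]
        apply ENNReal.ofReal_le_ofReal
        have : c ^ 2 * (β ^ 2 * (16 * Λ i₀ * ∑ j, Λ j * inner ℝ (b j) (v n ω) ^ 2)) ≤
            1 * (β ^ 2 * (16 * Λ i₀ * ∑ j, Λ j * inner ℝ (b j) (v n ω) ^ 2)) := by
          gcongr
        linarith
    _ = ∫⁻ ω, w ω * ENNReal.ofReal ((inner ℝ (b i₀) (v n ω) - t ω) ^ 2) ∂P
        + ENNReal.ofReal (16 * β ^ 2 * Λ i₀)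
          * ∫⁻ ω, w ω * ENNReal.ofReal (∑ j, Λ j * inner ℝ (b j) (v n ω) ^ 2) ∂P := by
        rw [lintegral_add_left (by fun_prop), lintegral_const_mul _ (by fun_prop)]
    _ ≤ _ := by
        rw [show 16 * (β ^ 2 * Λ i₀ ^ 2) = 16 * β ^ 2 * Λ i₀ * Λ i₀ by ring,
          ENNReal.ofReal_mul (p := 16 * β ^ 2 * Λ i₀) (by positivity), mul_assoc (ENNReal.ofReal _)]
        exact add_le_add le_rfl
          (mul_le_mul_right (lintegral_weighted_quadratic hw' hv' hΛ hΛ₀) _)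

end Dynamics

/-- Variances `Λ` with a spectral gap `g` below the leading one, a stepsize `β` that is small with
respect to them, and the factor `c` that makes the leading coordinate a martingale. -/
structure IsSmallStep {d : ℕ} (Λ : Fin d → ℝ) (i₀ : Fin d) (g β c : ℝ) : Prop where
  nonneg : ∀ k, 0 ≤ Λ k
  gap_pos : 0 < g
  gap_le : g ≤ Λ i₀
  gap : ∀ k, k ≠ i₀ → Λ k + g ≤ Λ i₀
  step_pos : 0 < β
  normalized : c * (1 + β * Λ i₀) = 1
  small : 1024 * (d * (Λ i₀ ^ 2 * g⁻¹ * β)) ≤ 1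

/-! ### Consequences of a small stepsize -/

section SmallStep

variable {d : ℕ} {Λ : Fin d → ℝ} {i₀ : Fin d} {g β c : ℝ}

lemma IsSmallStep.top_pos (h : IsSmallStep Λ i₀ g β c) : 0 < Λ i₀ := h.gap_pos.trans_le h.gap_le

lemma IsSmallStep.le_top (h : IsSmallStep Λ i₀ g β c) (k : Fin d) : Λ k ≤ Λ i₀ := by
  by_cases hk : k = i₀
  · rw [hk]
  · linarith [h.gap k hk, h.gap_pos]

lemma IsSmallStep.rate_pos (h : IsSmallStep Λ i₀ g β c) : 0 < Λ i₀ ^ 2 * g⁻¹ * β := by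
  have := h.top_pos
  have := h.gap_pos
  have := h.step_pos
  positivity

lemma IsSmallStep.rate_le (h : IsSmallStep Λ i₀ g β c) : 1024 * (Λ i₀ ^ 2 * g⁻¹ * β) ≤ 1 := by
  have h1 := h.small
  have hd : (1 : ℝ) ≤ d := by exact_mod_cast (Fin.pos i₀)
  nlinarith [h.rate_pos]

/-- Since the gap is at most the top variance, the single quantity `Λ i₀ ^ 2 * g⁻¹ * β` dominates
every other small parameter. -/
lemma IsSmallStep.step_mul_top_le (h : IsSmallStep Λ i₀ g β c) :
    β * Λ i₀ ≤ Λ i₀ ^ 2 * g⁻¹ * β := by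
  have h0 := h.top_pos
  have hg := h.gap_pos
  have hb := h.step_pos
  have : 1 ≤ Λ i₀ * g⁻¹ := by
    rw [← div_eq_mul_inv, one_le_div hg]; exact h.gap_le
  calc β * Λ i₀ = β * Λ i₀ * 1 := by ring
    _ ≤ β * Λ i₀ * (Λ i₀ * g⁻¹) := by gcongr
    _ = _ := by ring

lemma IsSmallStep.step_mul_gap_le (h : IsSmallStep Λ i₀ g β c) :
    β * g ≤ Λ i₀ ^ 2 * g⁻¹ * β :=
  (mul_le_mul_of_nonneg_left h.gap_le h.step_pos.le).trans h.step_mul_top_le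

lemma IsSmallStep.factor_pos (h : IsSmallStep Λ i₀ g β c) : 0 < c := by
  have h1 := h.normalized
  have h2 : 0 < 1 + β * Λ i₀ := by linarith [mul_pos h.step_pos h.top_pos]
  exact pos_of_mul_pos_left (by rw [h1]; exact one_pos) h2.le

lemma IsSmallStep.factor_le_one (h : IsSmallStep Λ i₀ g β c) : c ≤ 1 := by
  have h1 := h.normalized
  nlinarith [mul_pos h.factor_pos (mul_pos h.step_pos h.top_pos)]

lemma IsSmallStep.le_factor_sq (h : IsSmallStep Λ i₀ g β c) : 31 / 32 ≤ c ^ 2 := by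
  have h1 := h.normalized
  have h2 := h.factor_le_one
  have h3 := h.factor_pos
  have h4 := h.step_mul_top_le
  have h5 := h.rate_le
  have h6 := mul_pos h.step_pos h.top_pos
  have : 1 - 1 / 1024 ≤ c := by nlinarith
  nlinarith

/-- The contraction factor of the `k`-th coordinate. -/
lemma IsSmallStep.contraction (h : IsSmallStep Λ i₀ g β c) (k : Fin d) :
    c ^ 2 * (1 + 2 * β * Λ k) ≤ 1 - 31 / 16 * (β * (Λ i₀ - Λ k)) := by
  have h1 : 1 - c ^ 2 * (1 + 2 * β * Λ k)
      = c ^ 2 * (2 * (β * (Λ i₀ - Λ k)) + (β * Λ i₀) ^ 2) := by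
    have : (c * (1 + β * Λ i₀)) ^ 2 = 1 := by rw [h.normalized, one_pow]
    linear_combination -this
  have h2 := h.le_factor_sq
  have h3 : 0 ≤ β * (Λ i₀ - Λ k) :=
    mul_nonneg h.step_pos.le (by linarith [h.le_top k])
  nlinarith [mul_le_mul_of_nonneg_right h2 h3, mul_nonneg (sq_nonneg c) (sq_nonneg (β * Λ i₀))]

/-- The stationary level of the `k`-th coordinate. -/
def noiseLevel (Λ : Fin d → ℝ) (i₀ : Fin d) (β : ℝ) (k : Fin d) : ℝ :=
  64 * (β * (Λ i₀ * Λ k)) / (Λ i₀ - Λ k)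

lemma IsSmallStep.noiseLevel_nonneg (h : IsSmallStep Λ i₀ g β c) (k : Fin d) :
    0 ≤ noiseLevel Λ i₀ β k := by
  have := h.top_pos
  have := h.step_pos
  have := h.nonneg k
  have : 0 ≤ Λ i₀ - Λ k := by linarith [h.le_top k]
  unfold noiseLevel
  positivity

lemma IsSmallStep.step_mul_div_gap_le (h : IsSmallStep Λ i₀ g β c) (k : Fin d) :
    β * (Λ i₀ * Λ k) / g ≤ Λ i₀ ^ 2 * g⁻¹ * β := by
  have := h.top_pos
  have := h.step_pos
  have := h.gap_pos
  have := h.le_top k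
  calc β * (Λ i₀ * Λ k) / g ≤ β * (Λ i₀ * Λ i₀) / g := by gcongr
    _ = _ := by ring

lemma IsSmallStep.noiseLevel_le (h : IsSmallStep Λ i₀ g β c) {k : Fin d} (hk : k ≠ i₀) :
    noiseLevel Λ i₀ β k ≤ 64 * (Λ i₀ ^ 2 * g⁻¹ * β) := by
  have h0 := h.top_pos
  have h1 := h.step_pos
  have h2 := h.gap_pos
  have h3 := h.gap k hk
  have h4 := h.nonneg k
  calc noiseLevel Λ i₀ β k ≤ 64 * (β * (Λ i₀ * Λ k)) / g := by
        unfold noiseLevel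
        gcongr
        linarith
    _ = 64 * (β * (Λ i₀ * Λ k) / g) := by ring
    _ ≤ _ := by gcongr; exact h.step_mul_div_gap_le k

lemma IsSmallStep.sum_noiseLevel_le (h : IsSmallStep Λ i₀ g β c) :
    ∑ k ∈ Finset.univ.erase i₀, noiseLevel Λ i₀ β k ≤ 64 * (d * (Λ i₀ ^ 2 * g⁻¹ * β)) := by
  have hr := h.rate_pos
  calc ∑ k ∈ Finset.univ.erase i₀, noiseLevel Λ i₀ β k
      ≤ ∑ k ∈ Finset.univ.erase i₀, 64 * (Λ i₀ ^ 2 * g⁻¹ * β) :=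
        Finset.sum_le_sum fun k hk => h.noiseLevel_le (Finset.ne_of_mem_erase hk)
    _ ≤ ∑ k : Fin d, 64 * (Λ i₀ ^ 2 * g⁻¹ * β) :=
        Finset.sum_le_sum_of_subset_of_nonneg (Finset.erase_subset _ _) fun _ _ _ => by positivity
    _ = _ := by simp; ring

/-- The contraction factor used for all nonleading coordinates. -/
def decay (g β : ℝ) : ℝ := 1 - 15 / 8 * (β * g)

lemma IsSmallStep.decay_nonneg (h : IsSmallStep Λ i₀ g β c) : 0 ≤ decay g β := by
  unfold decay
  linarith [h.step_mul_gap_le, h.rate_le]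

lemma IsSmallStep.decay_lt_one (h : IsSmallStep Λ i₀ g β c) : decay g β < 1 := by
  unfold decay
  linarith [mul_pos h.step_pos h.gap_pos]

lemma IsSmallStep.sq_eq (h : IsSmallStep Λ i₀ g β c) :
    β ^ 2 * Λ i₀ ^ 2 = (Λ i₀ ^ 2 * g⁻¹ * β) * (β * g) := by
  have := h.gap_pos.ne'
  field_simp

/-- The geometric series of the transient contributes 1/(βg) up to a constant, which turns β²Λ² into
the rate Λ²β/g: the transient costs the same however long the run. -/
lemma IsSmallStep.sq_div_le (h : IsSmallStep Λ i₀ g β c) {L : ℝ} (hL : 0 ≤ L) :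
    β ^ 2 * Λ i₀ ^ 2 * (2 * L / (1 - decay g β)) ≤ 2 * L * (Λ i₀ ^ 2 * g⁻¹ * β) := by
  have h1 := mul_pos h.step_pos h.gap_pos
  have h2 := h.rate_pos
  rw [h.sq_eq]
  have : 1 - decay g β = 15 / 8 * (β * g) := by unfold decay; ring
  rw [this, mul_div_assoc', div_le_iff₀ (by positivity)]
  have : 0 ≤ Λ i₀ ^ 2 * g⁻¹ * β * (β * g) * L := by positivity
  nlinarith

end SmallStep

/-! ### The event that the leading coordinate is stable -/

section Stable

variable {d : ℕ} {Ω : Type*} {b : OrthonormalBasis (Fin d) ℝ (𝔼 d)} {i₀ : Fin d} {v : ℕ → Ω → 𝔼 d}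

/-- The starting points at which the leading coordinate is not too small compared to the rest. -/
def goodStart (b : OrthonormalBasis (Fin d) ℝ (𝔼 d)) (i₀ : Fin d) (L : ℝ) (v : Ω → 𝔼 d) :
    Set Ω :=
  {ω | inner ℝ (b i₀) (v ω) ≠ 0 ∧
    ∑ k ∈ Finset.univ.erase i₀, inner ℝ (b k) (v ω) ^ 2 ≤ L * inner ℝ (b i₀) (v ω) ^ 2}

/-- The event that the leading coordinate has stayed close to its starting value up to time
`n`. -/
def stable (b : OrthonormalBasis (Fin d) ℝ (𝔼 d)) (i₀ : Fin d) (L : ℝ) (v : ℕ → Ω → 𝔼 d)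
    (n : ℕ) : Set Ω :=
  {ω | ω ∈ goodStart b i₀ L (v 0) ∧ ∀ j ≤ n,
    (inner ℝ (b i₀) (v j ω) - inner ℝ (b i₀) (v 0 ω)) ^ 2 ≤ inner ℝ (b i₀) (v 0 ω) ^ 2 / 4}

/-- The weight `t⁻²` on the event `stable`, with `t` the initial leading coordinate. -/
def weight (b : OrthonormalBasis (Fin d) ℝ (𝔼 d)) (i₀ : Fin d) (L : ℝ) (v : ℕ → Ω → 𝔼 d)
    (n : ℕ) : Ω → ℝ≥0∞ :=
  (stable b i₀ L v n).indicator fun ω => ENNReal.ofReal ((inner ℝ (b i₀) (v 0 ω) ^ 2)⁻¹)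

lemma stable_anti {L : ℝ} {m n : ℕ} (hmn : m ≤ n) :
    stable b i₀ L v n ⊆ stable b i₀ L v m :=
  fun _ hω => ⟨hω.1, fun j hj => hω.2 j (hj.trans hmn)⟩

lemma measurableSet_goodStart {L : ℝ} {m : MeasurableSpace Ω} {V : Ω → 𝔼 d} (hV : Measurable V) :
    MeasurableSet (goodStart b i₀ L V) := by
  have : goodStart b i₀ L V = V ⁻¹' {x | inner ℝ (b i₀) x ≠ 0 ∧
      ∑ k ∈ Finset.univ.erase i₀, inner ℝ (b k) x ^ 2 ≤ L * inner ℝ (b i₀) x ^ 2} := rfl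
  rw [this]
  apply hV
  refine MeasurableSet.inter ?_ (measurableSet_le
    (f := fun x : 𝔼 d => ∑ k ∈ Finset.univ.erase i₀, inner ℝ (b k) x ^ 2)
    (g := fun x => L * inner ℝ (b i₀) x ^ 2) (by fun_prop) (by fun_prop))
  exact (measurableSet_eq_fun (f := fun x : 𝔼 d => inner ℝ (b i₀) x) (by fun_prop)
    measurable_const).compl

lemma weight_anti {L : ℝ} (n : ℕ) (ω : Ω) : weight b i₀ L v (n + 1) ω ≤ weight b i₀ L v n ω :=
  Set.indicator_le_indicator_of_subset (stable_anti n.le_succ) (fun _ => zero_le) ω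

end Stable

/-! ### Energy decay and the maximal inequality -/

section Dynamics

variable {d : ℕ} {Ω : Type*} [mΩ : MeasurableSpace Ω] {P : Measure Ω}
  {μ : Measure (𝔼 d)} {g c β : ℝ} {F : ℕ → MeasurableSpace Ω} {X v : ℕ → Ω → 𝔼 d}
  {b : OrthonormalBasis (Fin d) ℝ (𝔼 d)} {Λ : Fin d → ℝ} {i₀ : Fin d}

lemma moment_mono {w w' : Ω → ℝ≥0∞} (hw : ∀ ω, w ω ≤ w' ω) (V : Ω → 𝔼 d) (k : Fin d) :
    moment P b w V k ≤ moment P b w' V k :=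
  lintegral_mono fun ω => mul_le_mul_left (hw ω) _

lemma IsLinProcess.measurableSet_stable (h : IsLinProcess P μ c β F X v) (L : ℝ) (n : ℕ) :
    MeasurableSet[F n] (stable b i₀ L v n) := by
  have hm : ∀ j ≤ n, Measurable[F n] (v j) := fun j hj =>
    (h.measurable_past j).mono (h.mono hj) le_rfl
  have : stable b i₀ L v n = goodStart b i₀ L (v 0) ∩ ⋂ j ∈ Finset.range (n + 1),
      {ω | (inner ℝ (b i₀) (v j ω) - inner ℝ (b i₀) (v 0 ω)) ^ 2 ≤
        inner ℝ (b i₀) (v 0 ω) ^ 2 / 4} := by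
    ext ω
    simp [stable]
  rw [this]
  refine MeasurableSet.inter (measurableSet_goodStart (hm 0 (Nat.zero_le n))) ?_
  refine Finset.measurableSet_biInter _ fun j hj => ?_
  have hj' : j ≤ n := by simpa [Nat.lt_succ_iff] using hj
  have := hm j hj'
  have := hm 0 (Nat.zero_le n)
  exact measurableSet_le (mδ := F n)
    (f := fun ω => (inner ℝ (b i₀) (v j ω) - inner ℝ (b i₀) (v 0 ω)) ^ 2)
    (g := fun ω => inner ℝ (b i₀) (v 0 ω) ^ 2 / 4) (by fun_prop) (by fun_prop)

lemma IsLinProcess.measurable_weight (h : IsLinProcess P μ c β F X v) (L : ℝ) (n : ℕ) :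
    Measurable[F n] (weight b i₀ L v n) := by
  have := (h.measurable_past 0).mono (h.mono (Nat.zero_le n)) le_rfl
  exact Measurable.indicator (by fun_prop) (h.measurableSet_stable L n)

variable [IsProbabilityMeasure P]

/-- Decay of the weighted second moments of the nonleading coordinates to their stationary level,
as long as the leading coordinate stays bounded. -/
lemma IsLinProcess.moment_le (h : IsLinProcess P μ c β F X v) (hμ : HasMoments μ b Λ)
    (hs : IsSmallStep Λ i₀ g β c) {w : ℕ → Ω → ℝ≥0∞} (hw : ∀ n, Measurable[F n] (w n))
    (hanti : ∀ n ω, w (n + 1) ω ≤ w n ω) {L : ℝ} (hL : 0 ≤ L)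
    (h0 : ∑ k ∈ Finset.univ.erase i₀, moment P b (w 0) (v 0) k ≤ ENNReal.ofReal L) :
    ∃ E : Fin d → ℝ, (∀ k, 0 ≤ E k) ∧ ∑ k ∈ Finset.univ.erase i₀, E k ≤ 2 * L ∧
      ∀ n, (∀ m < n, moment P b (w m) (v m) i₀ ≤ ENNReal.ofReal 3) →
        ∀ k ∈ Finset.univ.erase i₀, moment P b (w n) (v n) k ≤
          ENNReal.ofReal (E k * decay g β ^ n + noiseLevel Λ i₀ β k) := by
  have t0 := hs.top_pos
  have b0 := hs.step_pos
  have g0 := hs.gap_pos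
  have c0 := hs.factor_pos
  have bg := mul_pos b0 g0
  have hfin : ∀ k ∈ Finset.univ.erase i₀, moment P b (w 0) (v 0) k ≠ ∞ := fun k hk =>
    ne_top_of_le_ne_top ENNReal.ofReal_ne_top
      ((Finset.single_le_sum (fun _ _ => zero_le) hk).trans h0)
  -- The second summand dominates the noise caused by the transient of the other coordinates: `1 /
  -- 16 * (β * g)` times it equals `16 * β ^ 2 * Λ k * Λ i₀ * (2 * L)`.
  set E : Fin d → ℝ := fun k =>
    (moment P b (w 0) (v 0) k).toReal + 512 * (β * (Λ i₀ * Λ k) / g) * L with hE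
  have hE0 : ∀ k, 0 ≤ E k := fun k => by
    have := hs.nonneg k
    simp only [hE]
    positivity
  have hsE : ∑ k ∈ Finset.univ.erase i₀, E k ≤ 2 * L := by
    have e1 : ∑ k ∈ Finset.univ.erase i₀, (moment P b (w 0) (v 0) k).toReal ≤ L := by
      rw [← ENNReal.toReal_sum hfin]
      exact ENNReal.toReal_le_of_le_ofReal hL h0
    have e2 : ∑ k ∈ Finset.univ.erase i₀, 512 * (β * (Λ i₀ * Λ k) / g) * L ≤ L := by
      calc ∑ k ∈ Finset.univ.erase i₀, 512 * (β * (Λ i₀ * Λ k) / g) * L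
          ≤ ∑ k : Fin d, 512 * (β * (Λ i₀ * Λ k) / g) * L :=
            Finset.sum_le_sum_of_subset_of_nonneg (Finset.erase_subset _ _) fun k _ _ => by
              have := hs.nonneg k
              positivity
        _ ≤ ∑ k : Fin d, 512 * (Λ i₀ ^ 2 * g⁻¹ * β) * L := by
            gcongr with k
            exact hs.step_mul_div_gap_le k
        _ = 512 * (d * (Λ i₀ ^ 2 * g⁻¹ * β)) * L := by simp; ring
        _ ≤ 1 * L := by
            gcongr
            have := hs.small
            have : 0 ≤ d * (Λ i₀ ^ 2 * g⁻¹ * β) := mul_nonneg (Nat.cast_nonneg _) hs.rate_pos.le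
            linarith
        _ = L := one_mul _
    simp only [hE, Finset.sum_add_distrib]
    linarith
  refine ⟨E, hE0, hsE, fun n hp => ?_⟩
  refine coord_le_of_recursion (s := Finset.univ.erase i₀)
    (h := fun n k => moment P b (w n) (v n) k)
    (p := fun n => moment P b (w n) (v n) i₀) (ρ := fun k => c ^ 2 * (1 + 2 * β * Λ k))
    (γ := fun k => 16 * β ^ 2 * Λ k * Λ i₀) hs.decay_nonneg (fun k _ => hE0 k)
    (fun k _ => hs.noiseLevel_nonneg k) (fun k _ => ?_) (fun k _ => ?_) hL hsE ?_ ?_ ?_ ?_ ?_ hp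
  · have := hs.nonneg k
    positivity
  · have := hs.nonneg k
    positivity
  · refine hs.sum_noiseLevel_le.trans ?_
    have := hs.small
    have : 0 ≤ d * (Λ i₀ ^ 2 * g⁻¹ * β) := mul_nonneg (Nat.cast_nonneg _) hs.rate_pos.le
    linarith
  · intro k hk
    have hgap := hs.gap k (Finset.ne_of_mem_erase hk)
    have h1 := hs.contraction k
    -- The contraction rate 31/16 exceeds the rate 15/8 of `decay` by 1/16; this slack pays for the
    -- coupling.
    have h2 : c ^ 2 * (1 + 2 * β * Λ k) ≤ decay g β - 1 / 16 * (β * g) := by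
      unfold decay
      nlinarith
    have h3 : 16 * β ^ 2 * Λ k * Λ i₀ * (2 * L) ≤ 1 / 16 * (β * g) * E k := by
      have : 512 * (β * (Λ i₀ * Λ k) / g) * L ≤ E k := by
        simp only [hE]
        linarith [ENNReal.toReal_nonneg (a := moment P b (w 0) (v 0) k)]
      calc 16 * β ^ 2 * Λ k * Λ i₀ * (2 * L)
          = 1 / 16 * (β * g) * (512 * (β * (Λ i₀ * Λ k) / g) * L) := by field_simp; ring
        _ ≤ _ := by gcongr
    nlinarith [mul_le_mul_of_nonneg_right h2 (hE0 k)]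
  · intro k hk
    have hgap := hs.gap k (Finset.ne_of_mem_erase hk)
    have hpos : 0 < Λ i₀ - Λ k := by linarith
    have h1 := hs.contraction k
    have hD := hs.noiseLevel_nonneg k
    have h2 : β * (Λ i₀ - Λ k) * noiseLevel Λ i₀ β k = 4 * (16 * β ^ 2 * Λ k * Λ i₀) := by
      unfold noiseLevel
      field_simp
      ring
    nlinarith [mul_le_mul_of_nonneg_right h1 hD, mul_nonneg (mul_nonneg b0.le hpos.le) hD]
  · intro k hk
    rw [← ENNReal.ofReal_toReal (hfin k hk)]
    apply ENNReal.ofReal_le_ofReal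
    have := hs.nonneg k
    simp only [hE, le_add_iff_nonneg_right]
    positivity
  · intro n k _
    refine (moment_mono (hanti n) _ _).trans ?_
    have := h.moment_succ_le hμ hs.nonneg hs.le_top b0.le c0.le hs.factor_le_one n (hw n) k
    rwa [← Finset.add_sum_erase _ _ (Finset.mem_univ i₀)] at this

/-- The total weighted second moment, as long as the leading coordinate stays bounded. -/
lemma IsLinProcess.sum_moment_le (h : IsLinProcess P μ c β F X v) (hμ : HasMoments μ b Λ)
    (hs : IsSmallStep Λ i₀ g β c) {w : ℕ → Ω → ℝ≥0∞} (hw : ∀ n, Measurable[F n] (w n))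
    (hanti : ∀ n ω, w (n + 1) ω ≤ w n ω) {L : ℝ} (hL : 0 ≤ L)
    (h0 : ∑ k ∈ Finset.univ.erase i₀, moment P b (w 0) (v 0) k ≤ ENNReal.ofReal L) {n : ℕ}
    (hp : ∀ m < n, moment P b (w m) (v m) i₀ ≤ ENNReal.ofReal 3) :
    ∑ k ∈ Finset.univ.erase i₀, moment P b (w n) (v n) k ≤
      ENNReal.ofReal (2 * L * decay g β ^ n +
        ∑ k ∈ Finset.univ.erase i₀, noiseLevel Λ i₀ β k) := by
  obtain ⟨E, hE0, hsE, hE⟩ := h.moment_le hμ hs hw hanti hL h0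
  refine (sum_le_of_coord_le hs.decay_nonneg (fun k _ => hE0 k)
    (fun k _ => hs.noiseLevel_nonneg k) (hE n hp)).trans (ENNReal.ofReal_le_ofReal ?_)
  have := pow_nonneg hs.decay_nonneg n
  gcongr

lemma IsLinProcess.total_moment_le (h : IsLinProcess P μ c β F X v) (hμ : HasMoments μ b Λ)
    (hs : IsSmallStep Λ i₀ g β c) {w : ℕ → Ω → ℝ≥0∞} (hw : ∀ n, Measurable[F n] (w n))
    (hanti : ∀ n ω, w (n + 1) ω ≤ w n ω) {L : ℝ} (hL : 0 ≤ L)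
    (h0 : ∑ k ∈ Finset.univ.erase i₀, moment P b (w 0) (v 0) k ≤ ENNReal.ofReal L) {n : ℕ}
    (hp : ∀ m ≤ n, moment P b (w m) (v m) i₀ ≤ ENNReal.ofReal 3) :
    ∑ k, moment P b (w n) (v n) k ≤ ENNReal.ofReal (4 + 2 * L * decay g β ^ n) := by
  rw [← Finset.add_sum_erase _ _ (Finset.mem_univ i₀)]
  refine (add_le_add (hp n le_rfl)
    (h.sum_moment_le hμ hs hw hanti hL h0 fun m hm => hp m hm.le)).trans ?_
  have h1 := pow_nonneg hs.decay_nonneg n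
  have h2 := hs.sum_noiseLevel_le
  have h3 := hs.small
  have h4 : 0 ≤ d * (Λ i₀ ^ 2 * g⁻¹ * β) := mul_nonneg (Nat.cast_nonneg _) hs.rate_pos.le
  have h5 : 0 ≤ ∑ k ∈ Finset.univ.erase i₀, noiseLevel Λ i₀ β k :=
    Finset.sum_nonneg fun k _ => hs.noiseLevel_nonneg k
  rw [← ENNReal.ofReal_add (by norm_num) (by positivity)]
  apply ENNReal.ofReal_le_ofReal
  linarith

lemma sum_ofReal_inner_sq (v : 𝔼 d) :
    ∑ k, ENNReal.ofReal (inner ℝ (b k) v ^ 2) = ENNReal.ofReal (‖v‖ ^ 2) := by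
  rw [← ENNReal.ofReal_sum_of_nonneg fun _ _ => sq_nonneg _]
  congr 1
  rw [← b.sum_sq_norm_inner_right v]
  simp

/-- From a unit start, the expected energy of the nonleading coordinates decays to a small
level. -/
lemma IsLinProcess.sum_moment_one_le (h : IsLinProcess P μ c β F X v) (hμ : HasMoments μ b Λ)
    (hs : IsSmallStep Λ i₀ g β c) (hv : ∀ᵐ ω ∂P, ‖v 0 ω‖ = 1) {n : ℕ}
    (hn : 64 * (β ^ 2 * Λ i₀ ^ 2 * n) ≤ 1) :
    ∑ k ∈ Finset.univ.erase i₀, moment P b (fun _ => 1) (v n) k ≤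
      ENNReal.ofReal (2 * decay g β ^ n + 64 * (d * (Λ i₀ ^ 2 * g⁻¹ * β))) := by
  have htot : ∑ k, moment P b (fun _ => 1) (v 0) k = ENNReal.ofReal 1 := by
    unfold moment
    have hm := h.measurable 0
    rw [← lintegral_finsetSum _ (fun k _ => by fun_prop)]
    simp only [one_mul, sum_ofReal_inner_sq]
    rw [lintegral_congr_ae (g := fun _ => ENNReal.ofReal 1)]
    · simp
    · filter_upwards [hv] with ω hω
      simp [hω]
  have h0 : ∑ k ∈ Finset.univ.erase i₀, moment P b (fun _ => 1) (v 0) k ≤ ENNReal.ofReal 1 := by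
    rw [← htot]
    exact Finset.sum_le_sum_of_subset (Finset.erase_subset _ _)
  have hp0 : moment P b (fun _ => 1) (v 0) i₀ ≤ ENNReal.ofReal 1 := by
    rw [← htot]
    exact Finset.single_le_sum (f := fun k => moment P b (fun _ => 1) (v 0) k)
      (fun _ _ => zero_le) (Finset.mem_univ i₀)
  have hw : ∀ n, Measurable[F n] (fun _ : Ω => (1 : ℝ≥0∞)) := fun _ => measurable_const
  -- Bootstrap: the bound 3 at earlier times controls the total energy, which controls the growth of
  -- the leading second moment, which stays below 3 since `n` is not too large.
  have hp : ∀ m ≤ n, moment P b (fun _ => 1) (v m) i₀ ≤ ENNReal.ofReal 3 := by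
    intro m
    induction m using Nat.strong_induction_on with
    | _ m ih =>
      intro hm
      have hβ2 : 0 ≤ β ^ 2 * Λ i₀ ^ 2 := by positivity
      have := accum_le (q := fun n => moment P b (fun _ => 1) (v n) i₀)
        (t := fun n => ∑ k, moment P b (fun _ => 1) (v n) k)
        hs.decay_nonneg hs.decay_lt_one zero_le_one
        (c := 16 * (β ^ 2 * Λ i₀ ^ 2)) (by positivity) zero_le_one hp0 (fun n => ?_)
        (n := m) (fun l hl => ?_)
      · refine this.trans (ENNReal.ofReal_le_ofReal ?_)
        have h1 := hs.sq_div_le zero_le_one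
        have h2 := hs.rate_le
        have h3 : β ^ 2 * Λ i₀ ^ 2 * m ≤ β ^ 2 * Λ i₀ ^ 2 * n := by gcongr
        linarith
      · have := h.lintegral_deviation_succ_le hμ hs.nonneg hs.le_top hs.step_pos.le
          hs.factor_pos.le hs.normalized n (hw n) (t := fun _ => 0) measurable_const
        simpa only [sub_zero, moment] using this
      · exact h.total_moment_le hμ hs (w := fun _ _ => 1) hw (fun _ _ => le_rfl) zero_le_one h0
          (fun k hk => ih k (by omega) (by omega))
  refine (h.sum_moment_le hμ hs (w := fun _ _ => 1) hw (fun _ _ => le_rfl) zero_le_one h0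
    (fun m hm => hp m hm.le)).trans (ENNReal.ofReal_le_ofReal ?_)
  linarith [hs.sum_noiseLevel_le]

/-- At time 0 stability reduces to `goodStart`, whose ratio condition gives the bound pointwise
after multiplying by t⁻². -/
lemma moment_weight_start_le {L : ℝ} (hv : Measurable (v 0)) :
    ∑ k ∈ Finset.univ.erase i₀, moment P b (weight b i₀ L v 0) (v 0) k ≤ ENNReal.ofReal L := by
  unfold moment
  have hw : Measurable (weight b i₀ L v 0) := by
    refine Measurable.indicator (by fun_prop) ?_
    have : stable b i₀ L v 0 = goodStart b i₀ L (v 0) := by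
      ext ω
      simp only [stable, Nat.le_zero, forall_eq, Set.mem_ofPred_eq, and_iff_left_iff_imp]
      intro _
      rw [sub_self]
      nlinarith [sq_nonneg (inner ℝ (b i₀) (v 0 ω))]
    rw [this]
    exact measurableSet_goodStart hv
  rw [← lintegral_finsetSum _ (fun k _ => by fun_prop)]
  calc _ ≤ ∫⁻ _, ENNReal.ofReal L ∂P := by
        refine lintegral_mono fun ω => ?_
        rw [← Finset.mul_sum, ← ENNReal.ofReal_sum_of_nonneg fun _ _ => sq_nonneg _]
        by_cases hω : ω ∈ stable b i₀ L v 0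
        · rw [weight, Set.indicator_of_mem hω, ← ENNReal.ofReal_mul (by positivity)]
          apply ENNReal.ofReal_le_ofReal
          have h1 : 0 < inner ℝ (b i₀) (v 0 ω) ^ 2 := by have := hω.1.1; positivity
          rw [inv_mul_le_iff₀ h1, mul_comm]
          exact hω.1.2
        · rw [weight, Set.indicator_of_notMem hω, zero_mul]
          exact zero_le
    _ = _ := by simp

/-- On the stable event the leading coordinate is at most 3/2 of its start in absolute value, and
9/4 ≤ 3. So the weighted recursion needs no bootstrap. -/
lemma moment_weight_top_le {L : ℝ} (n : ℕ) :
    moment P b (weight b i₀ L v n) (v n) i₀ ≤ ENNReal.ofReal 3 := by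
  unfold moment
  calc _ ≤ ∫⁻ _, ENNReal.ofReal 3 ∂P := by
        refine lintegral_mono fun ω => ?_
        by_cases hω : ω ∈ stable b i₀ L v n
        · rw [weight, Set.indicator_of_mem hω, ← ENNReal.ofReal_mul (by positivity)]
          apply ENNReal.ofReal_le_ofReal
          have h1 : 0 < inner ℝ (b i₀) (v 0 ω) ^ 2 := by have := hω.1.1; positivity
          rw [inv_mul_le_iff₀ h1]
          have h2 := hω.2 n le_rfl
          nlinarith [sq_nonneg (inner ℝ (b i₀) (v n ω) - 2 * inner ℝ (b i₀) (v 0 ω))]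
        · rw [weight, Set.indicator_of_notMem hω, zero_mul]
          exact zero_le
    _ = _ := by simp

/-- From a good start, the leading coordinate stays close to its starting value with high
probability. -/
lemma IsLinProcess.measure_goodStart_diff_stable_le (h : IsLinProcess P μ c β F X v)
    (hμ : HasMoments μ b Λ) (hs : IsSmallStep Λ i₀ g β c) {L : ℝ} (hL : 0 ≤ L) (n : ℕ) :
    P (goodStart b i₀ L (v 0) \ stable b i₀ L v n) ≤
      ENNReal.ofReal (256 * (β ^ 2 * Λ i₀ ^ 2 * n) + 128 * ((Λ i₀ ^ 2 * g⁻¹ * β) * L)) := by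
  set G := goodStart b i₀ L (v 0) with hG
  set S := stable b i₀ L v with hS
  set w := weight b i₀ L v with hw
  have hSm : ∀ n, MeasurableSet (S n) := fun n => h.le n _ (h.measurableSet_stable L n)
  -- Potential for the stopped martingale: relative squared deviation on surviving paths, plus 1/4
  -- for each path that has exited. A path pays at least 1/4 at its exit, so the potential grows
  -- only by the variance increments.
  set q : ℕ → ℝ≥0∞ := fun n =>
    ∫⁻ ω, w n ω * ENNReal.ofReal ((inner ℝ (b i₀) (v n ω) - inner ℝ (b i₀) (v 0 ω)) ^ 2) ∂P
      + ENNReal.ofReal (1 / 4) * P (G \ S n) with hq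
  have hG0 : G \ S 0 = ∅ := by
    rw [Set.sdiff_eq_empty]
    intro ω hω
    refine ⟨hω, fun j hj => ?_⟩
    obtain rfl : j = 0 := by omega
    rw [sub_self]
    nlinarith [sq_nonneg (inner ℝ (b i₀) (v 0 ω))]
  have hq0 : q 0 ≤ ENNReal.ofReal 0 := by
    simp [hq, hG0]
  have hrec : ∀ n, q (n + 1) ≤ q n + ENNReal.ofReal (16 * (β ^ 2 * Λ i₀ ^ 2)) *
      ∑ k, moment P b (w n) (v n) k := by
    intro n
    have hv0 := h.measurable 0
    have hvn := h.measurable (n + 1)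
    have hwn : Measurable (w (n + 1)) := (h.measurable_weight L (n + 1)).mono (h.le _) le_rfl
    have hdiff : P (G \ S (n + 1)) ≤ P (G \ S n) + P (S n \ S (n + 1)) := by
      refine (measure_mono fun ω hω => ?_).trans (measure_union_le _ _)
      by_cases hn : ω ∈ S n
      · exact Or.inr ⟨hn, hω.2⟩
      · exact Or.inl ⟨hω.1, hn⟩
    have hstep : ∫⁻ ω, w (n + 1) ω *
          ENNReal.ofReal ((inner ℝ (b i₀) (v (n + 1) ω) - inner ℝ (b i₀) (v 0 ω)) ^ 2) ∂P
        + ENNReal.ofReal (1 / 4) * P (S n \ S (n + 1)) ≤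
        ∫⁻ ω, w n ω *
          ENNReal.ofReal ((inner ℝ (b i₀) (v (n + 1) ω) - inner ℝ (b i₀) (v 0 ω)) ^ 2) ∂P := by
      rw [← setLIntegral_const, ← lintegral_indicator ((hSm n).diff (hSm (n + 1))),
        ← lintegral_add_left (by fun_prop)]
      refine lintegral_mono fun ω => ?_
      by_cases h1 : ω ∈ S (n + 1)
      · have h2 : ω ∉ S n \ S (n + 1) := fun h' => h'.2 h1
        rw [Set.indicator_of_notMem h2, add_zero]
        exact mul_le_mul_left (weight_anti n ω) _
      · have h2 : w (n + 1) ω = 0 := Set.indicator_of_notMem h1 _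
        rw [h2, zero_mul, zero_add]
        by_cases h3 : ω ∈ S n
        · have h4 : w n ω = ENNReal.ofReal ((inner ℝ (b i₀) (v 0 ω) ^ 2)⁻¹) :=
            Set.indicator_of_mem h3 _
          rw [Set.indicator_of_mem (show ω ∈ S n \ S (n + 1) from ⟨h3, h1⟩), h4,
            ← ENNReal.ofReal_mul (by positivity)]
          apply ENNReal.ofReal_le_ofReal
          have h5 : 0 < inner ℝ (b i₀) (v 0 ω) ^ 2 := by have := h3.1.1; positivity
          rw [le_inv_mul_iff₀ h5]
          by_contra hlt
          push Not at hlt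
          -- If the deviation at time `n + 1` were below the threshold, the path would still be
          -- stable.
          refine h1 ⟨h3.1, fun j hj => ?_⟩
          rcases Nat.lt_or_ge n j with hj' | hj'
          · obtain rfl : j = n + 1 := by omega
            linarith
          · exact h3.2 j hj'
        · rw [Set.indicator_of_notMem (fun h' => h3 h'.1)]
          exact zero_le
    have hdev := h.lintegral_deviation_succ_le hμ hs.nonneg hs.le_top hs.step_pos.le
      hs.factor_pos.le hs.normalized n (h.measurable_weight (b := b) (i₀ := i₀) L n)
      (t := fun ω => inner ℝ (b i₀) (v 0 ω)) (by
        have := (h.measurable_past 0).mono (h.mono (Nat.zero_le n)) le_rfl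
        fun_prop)
    calc q (n + 1) ≤ ∫⁻ ω, w (n + 1) ω *
          ENNReal.ofReal ((inner ℝ (b i₀) (v (n + 1) ω) - inner ℝ (b i₀) (v 0 ω)) ^ 2) ∂P
          + ENNReal.ofReal (1 / 4) * (P (G \ S n) + P (S n \ S (n + 1))) :=
          add_le_add le_rfl (mul_le_mul_right hdiff _)
      _ = (∫⁻ ω, w (n + 1) ω *
          ENNReal.ofReal ((inner ℝ (b i₀) (v (n + 1) ω) - inner ℝ (b i₀) (v 0 ω)) ^ 2) ∂P
          + ENNReal.ofReal (1 / 4) * P (S n \ S (n + 1)))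
          + ENNReal.ofReal (1 / 4) * P (G \ S n) := by ring
      _ ≤ _ := add_le_add (hstep.trans hdev) le_rfl
      _ = _ := by simp only [hq]; ring
  have hβ2 : 0 ≤ β ^ 2 * Λ i₀ ^ 2 := by positivity
  have key := accum_le hs.decay_nonneg hs.decay_lt_one hL
    (c := 16 * (β ^ 2 * Λ i₀ ^ 2)) (by positivity) le_rfl hq0 hrec (n := n) fun m _ =>
      h.total_moment_le hμ hs (fun n => h.measurable_weight L n) weight_anti hL
        (moment_weight_start_le (h.measurable 0)) (fun m _ => moment_weight_top_le m)
  have h4 : ENNReal.ofReal (1 / 4) * P (G \ S n) ≤ q n := le_add_self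
  have h5 : P (G \ S n) = ENNReal.ofReal 4 * (ENNReal.ofReal (1 / 4) * P (G \ S n)) := by
    rw [← mul_assoc, ← ENNReal.ofReal_mul (by norm_num)]
    norm_num
  rw [h5]
  refine (mul_le_mul_right (h4.trans key) _).trans ?_
  rw [← ENNReal.ofReal_mul (by norm_num)]
  apply ENNReal.ofReal_le_ofReal
  have h6 := hs.sq_div_le hL
  linarith

end Dynamics

/-! ### Anticoncentration on the sphere -/

section SmallBall

open scoped Pointwise

/-- The volume of a slab of the unit ball, orthogonal to the first coordinate axis. -/
lemma volume_slab_le (n : ℕ) (s : ℝ) :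
    volume {y : 𝔼 (n + 1) | |y 0| < s ∧ ‖y‖ < 1} ≤
      ENNReal.ofReal (2 * s) * volume (Metric.ball (0 : 𝔼 n) 1) := by
  have m1 := PiLp.volume_preserving_ofLp (Fin (n + 1))
  have m2 := volume_preserving_piFinSuccAbove (fun _ : Fin (n + 1) => ℝ) 0
  have m3 := (PiLp.volume_preserving_ofLp (Fin n))
  have m := m2.comp m1
  set B : Set (Fin n → ℝ) := {z | WithLp.toLp 2 z ∈ Metric.ball (0 : 𝔼 n) 1} with hB
  have hBm : MeasurableSet B := (PiLp.volume_preserving_toLp (Fin n)).measurable measurableSet_ball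
  have hBv : volume B = volume (Metric.ball (0 : 𝔼 n) 1) :=
    (PiLp.volume_preserving_toLp (Fin n)).measure_preimage measurableSet_ball.nullMeasurableSet
  have hT : MeasurableSet (Set.Ioo (-s) s ×ˢ B) := measurableSet_Ioo.prod hBm
  calc volume {y : 𝔼 (n + 1) | |y 0| < s ∧ ‖y‖ < 1}
      ≤ volume ((⇑(MeasurableEquiv.piFinSuccAbove (fun _ : Fin (n + 1) => ℝ) 0) ∘ WithLp.ofLp)
          ⁻¹' (Set.Ioo (-s) s ×ˢ B)) := by
        refine measure_mono fun y hy => ?_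
        refine ⟨abs_lt.1 hy.1, ?_⟩
        simp only [hB, Set.mem_ofPred_eq, mem_ball_zero_iff]
        refine lt_of_le_of_lt ?_ hy.2
        rw [EuclideanSpace.norm_eq, EuclideanSpace.norm_eq]
        apply Real.sqrt_le_sqrt
        rw [Fin.sum_univ_succ (fun i => ‖y i‖ ^ 2)]
        simp only [Function.comp, MeasurableEquiv.piFinSuccAbove_apply, Fin.insertNthEquiv_zero,
          Fin.consEquiv_symm_apply]
        exact le_add_of_nonneg_left (sq_nonneg _)
    _ = volume (Set.Ioo (-s) s ×ˢ B) := m.measure_preimage hT.nullMeasurableSet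
    _ = _ := by
        rw [Measure.volume_eq_prod, Measure.prod_prod, Real.volume_Ioo, hBv]
        congr 2; ring

/-- Log-convexity of Γ at the midpoint of x and x + 1, together with Γ(x + 1) = xΓ(x). -/
lemma Gamma_add_half_le {x : ℝ} (hx : 0 < x) : Real.Gamma (x + 1 / 2) ≤ √x * Real.Gamma x := by
  have h := Real.Gamma_mul_add_mul_le_rpow_Gamma_mul_rpow_Gamma hx (by linarith : 0 < x + 1)
    (by norm_num : (0 : ℝ) < 1 / 2) (by norm_num : (0 : ℝ) < 1 / 2) (by norm_num)
  have hG := Real.Gamma_pos_of_pos hx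
  rw [show (1 / 2 : ℝ) * x + 1 / 2 * (x + 1) = x + 1 / 2 by ring, ← Real.sqrt_eq_rpow,
    ← Real.sqrt_eq_rpow, Real.Gamma_add_one hx.ne', Real.sqrt_mul hx.le] at h
  calc _ ≤ _ := h
    _ = √x * (√(Real.Gamma x) * √(Real.Gamma x)) := by ring
    _ = _ := by rw [Real.mul_self_sqrt hG.le]

/-- Comparison of the volumes of unit balls in consecutive dimensions. -/
lemma two_mul_volume_ball_le {n : ℕ} (hn : 1 ≤ n) :
    ENNReal.ofReal 2 * volume (Metric.ball (0 : 𝔼 n) 1) ≤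
      ENNReal.ofReal (√(n + 1 : ℕ)) * volume (Metric.ball (0 : 𝔼 (n + 1)) 1) := by
  have : Nonempty (Fin n) := ⟨⟨0, hn⟩⟩
  rw [EuclideanSpace.volume_ball, EuclideanSpace.volume_ball]
  simp only [ENNReal.ofReal_one, one_pow, one_mul, Fintype.card_fin]
  have hx : (0 : ℝ) < (n : ℝ) / 2 + 1 := by positivity
  have hG := Real.Gamma_pos_of_pos hx
  have hG' := Real.Gamma_pos_of_pos (by positivity : (0 : ℝ) < (n : ℝ) / 2 + 1 + 1 / 2)
  have hπ : 0 < √Real.pi := Real.sqrt_pos.2 Real.pi_pos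
  rw [← ENNReal.ofReal_mul (by norm_num), ← ENNReal.ofReal_mul (by positivity)]
  apply ENNReal.ofReal_le_ofReal
  have hG2 := Gamma_add_half_le hx
  push_cast
  rw [show ((n : ℝ) + 1) / 2 + 1 = (n : ℝ) / 2 + 1 + 1 / 2 by ring, mul_div_assoc', mul_div_assoc',
    div_le_div_iff₀ hG hG', pow_succ]
  -- Squared, this is 2n + 4 ≤ π(n + 1); it holds from n = 1 on and fails at n = 0, hence the
  -- restriction to dimension at least 2.
  have key : 2 * √((n : ℝ) / 2 + 1) ≤ √((n : ℝ) + 1) * √Real.pi := by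
    rw [← Real.sqrt_mul (by positivity)]
    apply Real.le_sqrt_of_sq_le
    rw [mul_pow, Real.sq_sqrt hx.le]
    have h3 := Real.pi_gt_three
    have : (1 : ℝ) ≤ n := by exact_mod_cast hn
    nlinarith
  calc 2 * √Real.pi ^ n * Real.Gamma ((n : ℝ) / 2 + 1 + 1 / 2)
      ≤ 2 * √Real.pi ^ n * (√((n : ℝ) / 2 + 1) * Real.Gamma ((n : ℝ) / 2 + 1)) := by gcongr
    _ = (2 * √((n : ℝ) / 2 + 1)) * (√Real.pi ^ n * Real.Gamma ((n : ℝ) / 2 + 1)) := by ring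
    _ ≤ (√((n : ℝ) + 1) * √Real.pi) * (√Real.pi ^ n * Real.Gamma ((n : ℝ) / 2 + 1)) := by gcongr
    _ = _ := by ring

/-- The uniform measure is the volume fraction of the cone over the set, which reduces spherical
slabs to slabs of the ball. -/
lemma uniformSphere_apply {d : ℕ} (hd : 1 ≤ d) {A : Set (𝔼 d)} (hA : MeasurableSet A) :
    uniformSphere d A =
      (volume (Metric.ball (0 : 𝔼 d) 1))⁻¹ *
        volume (Set.Ioo (0 : ℝ) 1 • (A ∩ Metric.sphere 0 1)) := by
  have hA' : MeasurableSet ((Subtype.val : Metric.sphere (0 : 𝔼 d) 1 → 𝔼 d) ⁻¹' A) :=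
    measurable_subtype_coe hA
  rw [uniformSphere, Measure.map_apply measurable_subtype_coe hA, Measure.smul_apply,
    Measure.toSphere_apply' _ hA', Measure.toSphere_apply_univ, finrank_euclideanSpace,
    Fintype.card_fin, Subtype.image_preimage_coe, smul_eq_mul, Set.inter_comm]
  have h0 : (d : ℝ≥0∞) ≠ 0 := by
    rw [Nat.cast_ne_zero]; omega
  rw [ENNReal.mul_inv (Or.inl h0) (Or.inl (ENNReal.natCast_ne_top d)), mul_comm (d : ℝ≥0∞)⁻¹,
    mul_assoc, ← mul_assoc (d : ℝ≥0∞)⁻¹, ENNReal.inv_mul_cancel h0 (ENNReal.natCast_ne_top d),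
    one_mul]

/-- Anticoncentration of the uniform distribution on the sphere. -/
lemma uniformSphere_slab_le {d : ℕ} (hd : 2 ≤ d) {w : 𝔼 d} (hw : ‖w‖ = 1) (s : ℝ) :
    uniformSphere d {u | |inner ℝ w u| < s} ≤ ENNReal.ofReal (s * √d) := by
  rcases le_or_gt s 0 with hs | hs
  · have : {u : 𝔼 d | |inner ℝ w u| < s} = ∅ := by
      ext u
      simp only [Set.mem_ofPred_eq, Set.mem_empty_iff_false, iff_false, not_lt]
      exact hs.trans (abs_nonneg _)
    rw [this, measure_empty]
    exact zero_le
  obtain ⟨n, rfl⟩ : ∃ n, d = n + 1 := ⟨d - 1, by omega⟩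
  -- Rotate so that `w` becomes the first coordinate axis.
  obtain ⟨b, hb⟩ := Orthonormal.exists_orthonormalBasis_extension_of_card_eq
    (𝕜 := ℝ) (E := 𝔼 (n + 1)) (ι := Fin (n + 1)) (by simp) (v := fun _ => w) (s := {0}) (by
      constructor
      · rintro ⟨i, hi⟩
        simpa using hw
      · rintro ⟨i, hi⟩ ⟨j, hj⟩ hij
        exact absurd (Subtype.ext ((Set.mem_singleton_iff.1 hi).trans (Set.mem_singleton_iff.1 hj).symm)) hij)
  have hb0 : b 0 = w := hb 0 rfl
  have hmeas : MeasurableSet {u : 𝔼 (n + 1) | |inner ℝ w u| < s} :=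
    measurableSet_lt (by fun_prop) measurable_const
  rw [uniformSphere_apply (by omega) hmeas]
  have hsub : Set.Ioo (0 : ℝ) 1 • ({u : 𝔼 (n + 1) | |inner ℝ w u| < s} ∩ Metric.sphere 0 1) ⊆
      b.repr ⁻¹' {y | |y 0| < s ∧ ‖y‖ < 1} := by
    rintro _ ⟨r, hr, u, ⟨hu, hu1⟩, rfl⟩
    have hu1' : ‖u‖ = 1 := by simpa using hu1
    have hu' : |inner ℝ w u| < s := hu
    constructor
    · simp only [map_smul, PiLp.smul_apply, smul_eq_mul, OrthonormalBasis.repr_apply_apply, hb0,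
        abs_mul, abs_of_pos hr.1]
      nlinarith [hr.1, hr.2, abs_nonneg (inner ℝ w u)]
    · rw [LinearIsometryEquiv.norm_map, norm_smul, hu1', mul_one, Real.norm_eq_abs,
        abs_of_pos hr.1]
      exact hr.2
  have hmeas2 : MeasurableSet {y : 𝔼 (n + 1) | |y 0| < s ∧ ‖y‖ < 1} :=
    (measurableSet_lt (f := fun y : 𝔼 (n + 1) => |y 0|) (by fun_prop) measurable_const).inter
      (measurableSet_lt measurable_norm measurable_const)
  have hvol := (measure_mono hsub).trans_eq
    (b.measurePreserving_repr.measure_preimage hmeas2.nullMeasurableSet)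
  have hball : volume (Metric.ball (0 : 𝔼 (n + 1)) 1) ≠ 0 :=
    (Metric.measure_ball_pos _ _ one_pos).ne'
  have hball' : volume (Metric.ball (0 : 𝔼 (n + 1)) 1) ≠ ∞ := measure_ball_lt_top.ne
  rw [mul_comm, ← div_eq_mul_inv, ENNReal.div_le_iff hball hball']
  calc _ ≤ _ := hvol.trans (volume_slab_le n s)
    _ = ENNReal.ofReal s * (ENNReal.ofReal 2 * volume (Metric.ball (0 : 𝔼 n) 1)) := by
        rw [mul_comm 2 s, ENNReal.ofReal_mul hs.le, mul_assoc]
    _ ≤ ENNReal.ofReal s * (ENNReal.ofReal (√(n + 1 : ℕ)) *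
          volume (Metric.ball (0 : 𝔼 (n + 1)) 1)) :=
        mul_le_mul_right (two_mul_volume_ball_le (by omega)) _
    _ = _ := by rw [← mul_assoc, ← ENNReal.ofReal_mul hs.le]

lemma uniformSphere_slab_le_of_half_le_norm {d : ℕ} (hd : 2 ≤ d) {w : 𝔼 d} (hw : 1 / 2 ≤ ‖w‖)
    {s : ℝ} (hs : 0 ≤ s) :
    uniformSphere d {u | |inner ℝ w u| < s} ≤ ENNReal.ofReal (2 * s * √d) := by
  have hw0 : 0 < ‖w‖ := by linarith
  have h1 : ‖(‖w‖⁻¹ • w)‖ = 1 := by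
    rw [norm_smul, norm_inv, norm_norm, inv_mul_cancel₀ hw0.ne']
  refine (measure_mono fun u hu => ?_).trans (uniformSphere_slab_le hd h1 (2 * s))
  have hu' : |inner ℝ w u| < s := hu
  simp only [Set.mem_ofPred_eq, real_inner_smul_left, abs_mul, abs_inv, abs_norm]
  rw [inv_mul_lt_iff₀ hw0]
  nlinarith

lemma uniformSphere_compl_sphere {d : ℕ} :
    uniformSphere d {u | ‖u‖ ≠ 1} = 0 := by
  have : MeasurableSet {u : 𝔼 d | ‖u‖ ≠ 1} :=
    (measurableSet_eq_fun measurable_norm measurable_const).compl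
  rw [uniformSphere, Measure.map_apply measurable_subtype_coe this]
  have : (Subtype.val : Metric.sphere (0 : 𝔼 d) 1 → 𝔼 d) ⁻¹' {u | ‖u‖ ≠ 1} = ∅ := by
    ext u
    simp
  rw [this, measure_empty]

end SmallBall

/-! ### Independence of the past from the next sample -/

section Independence

variable {Ω 𝓐 𝓑 𝓒 : Type*} [MeasurableSpace Ω] [MeasurableSpace 𝓐] [MeasurableSpace 𝓑]
  [MeasurableSpace 𝓒] {P : Measure Ω} [IsProbabilityMeasure P]

lemma indepFun_pair_left {A : Ω → 𝓐} {B : Ω → 𝓑} {C : Ω → 𝓒} (hA : Measurable A)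
    (hB : Measurable B) (hC : Measurable C) (h1 : IndepFun A (fun ω => (B ω, C ω)) P)
    (h2 : IndepFun B C P) : IndepFun (fun ω => (A ω, B ω)) C P := by
  have := Measure.isProbabilityMeasure_map (μ := P) hA.aemeasurable
  have := Measure.isProbabilityMeasure_map (μ := P) hB.aemeasurable
  have := Measure.isProbabilityMeasure_map (μ := P) hC.aemeasurable
  have h3 : IndepFun A B P := h1.comp measurable_id measurable_fst
  rw [indepFun_iff_map_prod_eq_prod_map_map (hA.prodMk hB).aemeasurable hC.aemeasurable,
    (indepFun_iff_map_prod_eq_prod_map_map hA.aemeasurable hB.aemeasurable).1 h3]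
  have e1 := (indepFun_iff_map_prod_eq_prod_map_map hA.aemeasurable
    (hB.prodMk hC).aemeasurable).1 h1
  rw [(indepFun_iff_map_prod_eq_prod_map_map hB.aemeasurable hC.aemeasurable).1 h2] at e1
  have e2 := congrArg (Measure.map MeasurableEquiv.prodAssoc.symm) e1
  rw [Measure.map_map (MeasurableEquiv.measurable _) (hA.prodMk (hB.prodMk hC))] at e2
  have e3 := congrArg (Measure.map MeasurableEquiv.prodAssoc.symm)
    (measurePreserving_prodAssoc (P.map A) (P.map B) (P.map C)).map_eq
  rw [Measure.map_map (MeasurableEquiv.measurable _) (MeasurableEquiv.measurable _)] at e3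
  rw [← e3, MeasurableEquiv.symm_comp_self, Measure.map_id] at e2
  exact e2

end Independence

/-! ### The linear recursion with a uniform start -/

section Setup

variable {d : ℕ} {Ω : Type*} [mΩ : MeasurableSpace Ω]

/-- The linear recursion from a starting point along a data stream. -/
def linIter (c β : ℝ) (u : 𝔼 d) (x : ℕ → 𝔼 d) : ℕ → 𝔼 d
  | 0 => u
  | n + 1 => linStep c β (x n) (linIter c β u x n)

/-- The information contained in the starting point and the first `n` samples. -/
abbrev past (u0 : Ω → 𝔼 d) (X : ℕ → Ω → 𝔼 d) (n : ℕ) : MeasurableSpace Ω :=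
  MeasurableSpace.comap (fun ω => (u0 ω, fun i : Finset.range n => X i ω)) inferInstance

lemma isLinProcess_linIter {P : Measure Ω} [IsProbabilityMeasure P] {μ : Measure (𝔼 d)}
    {X : ℕ → Ω → 𝔼 d} {u0 : Ω → 𝔼 d} (hX : ∀ n, Measurable (X n)) (hu : Measurable u0)
    (hlaw : ∀ n, P.map (X n) = μ) (hind : iIndepFun X P)
    (hind0 : IndepFun u0 (fun ω n => X n ω) P) (c β : ℝ) {y : Ω → 𝔼 d}
    (hy : Measurable[past u0 X 0] y) :
    IsLinProcess P μ c β (past u0 X) X (fun n ω => linIter c β (y ω) (fun m => X m ω) n) where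
  mono := by
    intro m n hmn
    have : (fun ω => (u0 ω, fun i : Finset.range m => X i ω)) =
        (fun q : (𝔼 d) × (Finset.range n → 𝔼 d) =>
          (q.1, fun i : Finset.range m => q.2 ⟨i, Finset.range_mono hmn i.2⟩)) ∘
        (fun ω => (u0 ω, fun i : Finset.range n => X i ω)) := rfl
    unfold past
    rw [this, ← MeasurableSpace.comap_comp]
    apply MeasurableSpace.comap_mono
    exact Measurable.comap_le (by fun_prop)
  le := fun n => Measurable.comap_le (hu.prodMk (measurable_pi_lambda _ fun i => hX i))
  measurable_start := hy
  measurable_sample := by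
    intro n
    have : X n = (fun q : (𝔼 d) × (Finset.range (n + 1) → 𝔼 d) =>
        q.2 ⟨n, Finset.self_mem_range_succ n⟩) ∘
        (fun ω => (u0 ω, fun i : Finset.range (n + 1) => X i ω)) := rfl
    rw [this]
    exact Measurable.comp (by fun_prop) (comap_measurable _)
  indep := by
    intro n
    have hXr : Measurable fun ω => fun i : Finset.range n => X i ω :=
      measurable_pi_lambda _ fun i => hX i
    refine indepFun_pair_left hu hXr (hX n) ?_ ?_
    · refine hind0.comp (φ := id)
        (ψ := fun x : ℕ → 𝔼 d => ((fun i : Finset.range n => x i), x n)) measurable_id ?_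
      fun_prop
    · have := hind.indepFun_finset (Finset.range n) {n} (by simp) hX
      exact this.comp (φ := id) (ψ := fun x : ({n} : Finset ℕ) → 𝔼 d => x ⟨n, by simp⟩)
        measurable_id (by fun_prop)
  law := hlaw
  step := fun _ _ => rfl

lemma measurable_linIter (c β : ℝ) (n : ℕ) :
    Measurable fun q : (𝔼 d) × (ℕ → 𝔼 d) => linIter c β q.1 q.2 n := by
  induction n with
  | zero => exact measurable_fst
  | succ n ih =>
    have : Measurable fun q : (𝔼 d) × (ℕ → 𝔼 d) => q.2 n := by fun_prop
    exact (measurable_linStep c β).comp (this.prodMk ih)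

/-- The linear recursion as a linear map of the starting point. -/
def linIterMap (c β : ℝ) (x : ℕ → 𝔼 d) (n : ℕ) : (𝔼 d) →ₗ[ℝ] (𝔼 d) where
  toFun u := linIter c β u x n
  map_add' u v := by
    induction n with
    | zero => rfl
    | succ n ih => simp only [linIter, ih, linStep_add]
  map_smul' t u := by
    induction n with
    | zero => rfl
    | succ n ih => simp only [linIter, ih, linStep_smul, RingHom.id_apply]

/-- For a fixed data stream along which the recursion does not shrink the direction `e`, a uniform
starting point rarely has a small coordinate in the direction `e` after `n` steps. -/
lemma uniformSphere_linIter_le (hd : 2 ≤ d) (c β : ℝ) (x : ℕ → 𝔼 d) (n : ℕ) {e : 𝔼 d}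
    (he : ‖e‖ = 1) (hx : 1 / 2 ≤ inner ℝ e (linIter c β e x n)) {s : ℝ} (hs : 0 ≤ s) :
    uniformSphere d {u | |inner ℝ e (linIter c β u x n)| < s} ≤
      ENNReal.ofReal (2 * s * √d) := by
  set w := LinearMap.adjoint (linIterMap c β x n) e with hw
  have h1 : ∀ u, inner ℝ e (linIter c β u x n) = inner ℝ w u := fun u =>
    (LinearMap.adjoint_inner_left (linIterMap c β x n) u e).symm
  have h2 : 1 / 2 ≤ ‖w‖ := by
    rw [h1] at hx
    -- The diagonal entry of the product of updates bounds the norm of its adjoint applied to `e`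
    -- from below.
    calc (1 : ℝ) / 2 ≤ inner ℝ w e := hx
      _ ≤ ‖w‖ * ‖e‖ := real_inner_le_norm _ _
      _ = ‖w‖ := by rw [he, mul_one]
  simp only [h1]
  exact uniformSphere_slab_le_of_half_le_norm hd h2 hs

/-- Anticoncentration of the leading coordinate after `n` steps. -/
lemma measure_small_top_le {P : Measure Ω} [IsProbabilityMeasure P] (hd : 2 ≤ d)
    {X : ℕ → Ω → 𝔼 d} {u0 : Ω → 𝔼 d} (hX : ∀ n, Measurable (X n)) (hu : Measurable u0)
    (hlaw : P.map u0 = uniformSphere d) (hind0 : IndepFun u0 (fun ω n => X n ω) P)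
    (c β : ℝ) (n : ℕ) {e : 𝔼 d} (he : ‖e‖ = 1) {s : ℝ} (hs : 0 ≤ s) :
    P {ω | 1 / 2 ≤ inner ℝ e (linIter c β e (fun m => X m ω) n) ∧
      |inner ℝ e (linIter c β (u0 ω) (fun m => X m ω) n)| < s} ≤
      ENNReal.ofReal (2 * s * √d) := by
  have hXm : Measurable fun ω n => X n ω := measurable_pi_lambda _ hX
  have hmap := Measure.isProbabilityMeasure_map (μ := P) hXm.aemeasurable
  have hmap' := Measure.isProbabilityMeasure_map (μ := P) hu.aemeasurable
  set T : Set ((𝔼 d) × (ℕ → 𝔼 d)) := {q | 1 / 2 ≤ inner ℝ e (linIter c β e q.2 n) ∧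
    |inner ℝ e (linIter c β q.1 q.2 n)| < s} with hT
  have m1 := measurable_linIter (d := d) c β n
  have m2 : Measurable fun q : (𝔼 d) × (ℕ → 𝔼 d) => linIter c β e q.2 n :=
    m1.comp (measurable_const.prodMk measurable_snd)
  have hTm : MeasurableSet T :=
    (measurableSet_le (f := fun _ => (1 / 2 : ℝ)) measurable_const
      (g := fun q : (𝔼 d) × (ℕ → 𝔼 d) => inner ℝ e (linIter c β e q.2 n))
      (by fun_prop)).inter
      (measurableSet_lt (f := fun q : (𝔼 d) × (ℕ → 𝔼 d) => |inner ℝ e (linIter c β q.1 q.2 n)|)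
        (by fun_prop) measurable_const)
  have e1 : P {ω | 1 / 2 ≤ inner ℝ e (linIter c β e (fun m => X m ω) n) ∧
      |inner ℝ e (linIter c β (u0 ω) (fun m => X m ω) n)| < s} =
      ((P.map u0).prod (P.map fun ω n => X n ω)) T := by
    rw [← (indepFun_iff_map_prod_eq_prod_map_map hu.aemeasurable hXm.aemeasurable).1 hind0,
      Measure.map_apply (hu.prodMk hXm) hTm]
    rfl
  rw [e1, Measure.prod_apply_symm hTm]
  calc _ ≤ ∫⁻ _, ENNReal.ofReal (2 * s * √d) ∂(P.map fun ω n => X n ω) := by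
        refine lintegral_mono fun x => ?_
        by_cases hx : 1 / 2 ≤ inner ℝ e (linIter c β e x n)
        -- With the data fixed, only the starting point is random.
        · refine le_trans (measure_mono fun u hu => hu.2) ?_
          rw [hlaw]
          exact uniformSphere_linIter_le hd c β x n he hx hs
        · have : (fun u => (u, x)) ⁻¹' T = ∅ := by
            ext u
            simp only [hT, Set.mem_preimage, Set.mem_ofPred_eq, Set.mem_empty_iff_false, iff_false]
            exact fun h => hx h.1
          rw [this, measure_empty]
          exact zero_le
    _ = _ := by simp

end Setup

/-! ### Moments of the isotropic vector -/

section Subgaussian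

variable {d : ℕ} {Ω' : Type*} [MeasurableSpace Ω'] {P' : Measure Ω'}
  {Z : Ω' → 𝔼 d}

lemma IsIsotropicSubgaussian.lintegral_inner_pow_four_le (hZ : IsIsotropicSubgaussian P' Z)
    {v : 𝔼 d} (hv : ‖v‖ = 1) :
    ∫⁻ ω, ENNReal.ofReal (inner ℝ v (Z ω) ^ 4) ∂P' ≤ ENNReal.ofReal 16 := by
  have h1 : psiTwoNorm P' (fun ω => inner ℝ v (Z ω)) ≤ 1 :=
    (le_iSup (fun v : Metric.sphere (0 : 𝔼 d) 1 =>
      psiTwoNorm P' (fun ω => inner ℝ (v : 𝔼 d) (Z ω))) ⟨v, by simpa using hv⟩).trans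
      hZ.psiTwo_le_one
  -- The exponent p = 4 gives an L⁴ norm of at most √4 = 2, hence a fourth moment of at most 16.
  have h2 := (le_iSup (fun p : {p : ℝ // 1 ≤ p} =>
    ENNReal.ofReal ((p : ℝ) ^ (-(1 / 2) : ℝ)) *
      eLpNorm (fun ω => inner ℝ v (Z ω)) (ENNReal.ofReal (p : ℝ)) P') ⟨4, by norm_num⟩).trans h1
  have h3 : ((4 : ℝ) ^ (-(1 / 2) : ℝ)) = 1 / 2 := by
    rw [Real.rpow_neg (by norm_num), ← Real.sqrt_eq_rpow,
      show (4 : ℝ) = 2 ^ 2 by norm_num, Real.sqrt_sq (by norm_num)]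
    norm_num
  simp only [h3] at h2
  have h4 : eLpNorm (fun ω => inner ℝ v (Z ω)) (ENNReal.ofReal 4) P' ≤ ENNReal.ofReal 2 := by
    calc _ = ENNReal.ofReal 2 * (ENNReal.ofReal (1 / 2) *
          eLpNorm (fun ω => inner ℝ v (Z ω)) (ENNReal.ofReal 4) P') := by
          rw [← mul_assoc, ← ENNReal.ofReal_mul (by norm_num)]
          norm_num
      _ ≤ ENNReal.ofReal 2 * 1 := mul_le_mul_right h2 _
      _ = _ := mul_one _
  rw [eLpNorm_eq_lintegral_rpow_enorm_toReal (by simp) (by simp),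
    ENNReal.toReal_ofReal (by norm_num)] at h4
  have h5 := ENNReal.rpow_le_rpow h4 (by norm_num : (0 : ℝ) ≤ 4)
  rw [← ENNReal.rpow_mul, one_div_mul_cancel (by norm_num), ENNReal.rpow_one,
    ENNReal.ofReal_rpow_of_pos (by norm_num)] at h5
  convert h5 using 2
  · funext ω
    rw [Real.enorm_eq_ofReal_abs, ENNReal.ofReal_rpow_of_nonneg (abs_nonneg _) (by norm_num)]
    congr 1
    rw [show (4 : ℝ) = ((4 : ℕ) : ℝ) by norm_num, Real.rpow_natCast,
      (by decide : Even 4).pow_abs]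
  · rw [show (4 : ℝ) = ((4 : ℕ) : ℝ) by norm_num, Real.rpow_natCast]
    norm_num

/-- By homogeneity it suffices to treat unit vectors, where (ab)² ≤ (a⁴ + b⁴)/2 reduces to fourth
moments. -/
lemma IsIsotropicSubgaussian.lintegral_mul_sq_le (hZ : IsIsotropicSubgaussian P' Z) (x y : 𝔼 d) :
    ∫⁻ ω, ENNReal.ofReal ((inner ℝ x (Z ω) * inner ℝ y (Z ω)) ^ 2) ∂P' ≤
      ENNReal.ofReal (16 * (‖x‖ ^ 2 * ‖y‖ ^ 2)) := by
  have hm := hZ.measurable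
  rcases eq_or_ne x 0 with rfl | hx
  · simp
  rcases eq_or_ne y 0 with rfl | hy
  · simp
  have hx0 : 0 < ‖x‖ := norm_pos_iff.2 hx
  have hy0 : 0 < ‖y‖ := norm_pos_iff.2 hy
  have unit : ∀ v : 𝔼 d, v ≠ 0 → ‖(‖v‖⁻¹ • v)‖ = 1 := fun v hv => by
    rw [norm_smul, norm_inv, norm_norm, inv_mul_cancel₀ (norm_pos_iff.2 hv).ne']
  have hxu := hZ.lintegral_inner_pow_four_le (unit x hx)
  have hyu := hZ.lintegral_inner_pow_four_le (unit y hy)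
  set x' := ‖x‖⁻¹ • x with hx'
  set y' := ‖y‖⁻¹ • y with hy'
  have ex : x = ‖x‖ • x' := by rw [hx', smul_smul, mul_inv_cancel₀ hx0.ne', one_smul]
  have ey : y = ‖y‖ • y' := by rw [hy', smul_smul, mul_inv_cancel₀ hy0.ne', one_smul]
  calc ∫⁻ ω, ENNReal.ofReal ((inner ℝ x (Z ω) * inner ℝ y (Z ω)) ^ 2) ∂P'
      ≤ ∫⁻ ω, ENNReal.ofReal (‖x‖ ^ 2 * ‖y‖ ^ 2 / 2) * (ENNReal.ofReal (inner ℝ x' (Z ω) ^ 4)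
        + ENNReal.ofReal (inner ℝ y' (Z ω) ^ 4)) ∂P' := by
        refine lintegral_mono fun ω => ?_
        have e1 : inner ℝ x (Z ω) = ‖x‖ * inner ℝ x' (Z ω) := by
          conv_lhs => rw [ex, real_inner_smul_left]
        have e2 : inner ℝ y (Z ω) = ‖y‖ * inner ℝ y' (Z ω) := by
          conv_lhs => rw [ey, real_inner_smul_left]
        rw [← ENNReal.ofReal_add (by positivity) (by positivity),
          ← ENNReal.ofReal_mul (by positivity)]
        apply ENNReal.ofReal_le_ofReal
        rw [e1, e2]
        set a := inner ℝ x' (Z ω)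
        set b := inner ℝ y' (Z ω)
        have : (a * b) ^ 2 ≤ (a ^ 4 + b ^ 4) / 2 := by nlinarith [sq_nonneg (a ^ 2 - b ^ 2)]
        calc (‖x‖ * a * (‖y‖ * b)) ^ 2 = ‖x‖ ^ 2 * ‖y‖ ^ 2 * (a * b) ^ 2 := by ring
          _ ≤ ‖x‖ ^ 2 * ‖y‖ ^ 2 * ((a ^ 4 + b ^ 4) / 2) := by gcongr
          _ = _ := by ring
    _ ≤ ENNReal.ofReal (‖x‖ ^ 2 * ‖y‖ ^ 2 / 2) * (ENNReal.ofReal 16 + ENNReal.ofReal 16) := by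
        rw [lintegral_const_mul _ (by fun_prop), lintegral_add_left (by fun_prop)]
        exact mul_le_mul_right (add_le_add hxu hyu) _
    _ = _ := by
        rw [← ENNReal.ofReal_add (by norm_num) (by norm_num),
          ← ENNReal.ofReal_mul (by positivity)]
        congr 1; ring

lemma IsIsotropicSubgaussian.integrable_mul_sq (hZ : IsIsotropicSubgaussian P' Z) (x y : 𝔼 d) :
    Integrable (fun ω => (inner ℝ x (Z ω) * inner ℝ y (Z ω)) ^ 2) P' := by
  have hm := hZ.measurable
  refine ⟨by fun_prop, ?_⟩
  rw [hasFiniteIntegral_iff_ofReal (Filter.Eventually.of_forall fun ω => sq_nonneg _)]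
  exact (hZ.lintegral_mul_sq_le x y).trans_lt ENNReal.ofReal_lt_top

lemma IsIsotropicSubgaussian.integral_mul_sq_le (hZ : IsIsotropicSubgaussian P' Z) (x y : 𝔼 d) :
    ∫ ω, (inner ℝ x (Z ω) * inner ℝ y (Z ω)) ^ 2 ∂P' ≤ 16 * (‖x‖ ^ 2 * ‖y‖ ^ 2) := by
  have hm := hZ.measurable
  rw [integral_eq_lintegral_of_nonneg_ae (Filter.Eventually.of_forall fun ω => sq_nonneg _)
    (by fun_prop)]
  exact ENNReal.toReal_le_of_le_ofReal (by positivity) (hZ.lintegral_mul_sq_le x y)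

variable [IsProbabilityMeasure P']

lemma IsIsotropicSubgaussian.integrable_mul (hZ : IsIsotropicSubgaussian P' Z) (x y : 𝔼 d) :
    Integrable (fun ω => inner ℝ x (Z ω) * inner ℝ y (Z ω)) P' := by
  have hm := hZ.measurable
  refine ((integrable_const (1 : ℝ)).add (hZ.integrable_mul_sq x y)).mono' (by fun_prop)
    (Filter.Eventually.of_forall fun ω => ?_)
  set a := inner ℝ x (Z ω) * inner ℝ y (Z ω)
  simp only [Pi.add_apply, Real.norm_eq_abs]
  nlinarith [sq_abs a, sq_nonneg (|a| - 1), abs_nonneg a]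

lemma IsIsotropicSubgaussian.integral_mul (hZ : IsIsotropicSubgaussian P' Z) (x y : 𝔼 d) :
    ∫ ω, inner ℝ x (Z ω) * inner ℝ y (Z ω) ∂P' = inner ℝ x y := by
  have hint : ∀ i j, Integrable (fun ω => Z ω i * Z ω j) P' := fun i j => by
    have := hZ.integrable_mul (EuclideanSpace.single i 1) (EuclideanSpace.single j 1)
    simpa only [EuclideanSpace.inner_single_left, map_one, one_mul] using this
  have e : (fun ω => inner ℝ x (Z ω) * inner ℝ y (Z ω)) =
      fun ω => ∑ i, ∑ j, (x i * y j) * (Z ω i * Z ω j) := by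
    funext ω
    simp only [PiLp.inner_apply, RCLike.inner_apply, conj_trivial, Finset.sum_mul_sum]
    refine Finset.sum_congr rfl fun i _ => Finset.sum_congr rfl fun j _ => ?_
    ring
  rw [e, integral_finsetSum _ fun i _ => integrable_finsetSum _ fun j _ => (hint i j).const_mul _]
  simp_rw [integral_finsetSum _ fun j _ => (hint _ j).const_mul _, integral_const_mul,
    hZ.second_moment, Matrix.one_apply]
  simp [PiLp.inner_apply, mul_comm]

end Subgaussian

/-! ### Diagonalization of the covariance -/

section Spectral

variable {d : ℕ}

lemma inner_matVec {A : Matrix (Fin d) (Fin d) ℝ} (hA : A.IsHermitian) (x y : 𝔼 d) :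
    inner ℝ x (matVec A y) = inner ℝ (matVec A x) y := by
  have hT : A.transpose = A := by simpa using hA.eq
  simp only [matVec, EuclideanSpace.inner_eq_star_dotProduct, star_trivial]
  rw [dotProduct_comm, Matrix.dotProduct_mulVec, ← Matrix.mulVec_transpose, hT,
    dotProduct_comm]

lemma matVec_matVec (A B : Matrix (Fin d) (Fin d) ℝ) (x : 𝔼 d) :
    matVec A (matVec B x) = matVec (A * B) x := by
  simp [matVec, Matrix.mulVec_mulVec]

lemma measurable_matVec (A : Matrix (Fin d) (Fin d) ℝ) : Measurable (matVec A) := by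
  have : matVec A = fun x => Matrix.toEuclideanLin A x := by
    funext x
    simp [matVec, Matrix.toLpLin_apply]
  rw [this]
  exact (LinearMap.continuous_of_finiteDimensional _).measurable

/-- The eigenbasis ordered by decreasing eigenvalues. -/
lemma exists_eigenbasis {S : Matrix (Fin d) (Fin d) ℝ} (hS : S.IsHermitian) :
    ∃ b : OrthonormalBasis (Fin d) ℝ (𝔼 d),
      ∀ i : Fin d, matVec S (b i) = eigval hS (i + 1) • b i := by
  set e0 : Fin (Fintype.card (Fin d)) ≃ Fin d :=
    Fintype.equivOfCardEq (Fintype.card_fin _) with he0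
  set σ : Fin d ≃ Fin d := (finCongr (Fintype.card_fin d).symm).trans e0 with hσ
  refine ⟨hS.eigenvectorBasis.reindex σ.symm, fun i => ?_⟩
  have h1 := hS.mulVec_eigenvectorBasis (σ i)
  have h2 : hS.eigenvalues (σ i) = eigval hS (i + 1) := by
    have hi : 1 ≤ (i : ℕ) + 1 ∧ (i : ℕ) + 1 ≤ d := ⟨by omega, i.2⟩
    rw [eigval, dif_pos hi, Matrix.IsHermitian.eigenvalues]
    congr 1
    simp only [hσ, Equiv.trans_apply]
    rw [← he0, Equiv.symm_apply_apply]
    rfl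
  simp only [OrthonormalBasis.reindex_apply, Equiv.symm_symm, matVec]
  rw [h1, h2]
  rfl

/-- Moving the symmetric square root onto the test vectors turns projections of the sample into
projections of `Z`; then ⟨Rx, Ry⟩ = ⟨Sx, y⟩ is diagonal in the eigenbasis. -/
lemma hasMoments_of_isotropic {S R : Matrix (Fin d) (Fin d) ℝ} (hR : R.IsHermitian)
    (hRS : R * R = S) (hS : S.IsHermitian) {b : OrthonormalBasis (Fin d) ℝ (𝔼 d)} {Λ : Fin d → ℝ}
    (hb : ∀ i, matVec S (b i) = Λ i • b i)
    {Ω' : Type*} [MeasurableSpace Ω'] {P' : Measure Ω'} [IsProbabilityMeasure P']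
    {Z : Ω' → 𝔼 d} (hZ : IsIsotropicSubgaussian P' Z) :
    HasMoments (P'.map fun ω => matVec R (Z ω)) b Λ := by
  have hm : Measurable fun ω => matVec R (Z ω) := (measurable_matVec R).comp hZ.measurable
  have key : ∀ x y : 𝔼 d, inner ℝ (matVec R x) (matVec R y) = inner ℝ (matVec S x) y := by
    intro x y
    rw [inner_matVec hR, matVec_matVec, hRS]
  have e : ∀ k v ω, inner ℝ (b k) (matVec R (Z ω)) * inner ℝ (matVec R (Z ω)) v =
      inner ℝ (matVec R (b k)) (Z ω) * inner ℝ (matVec R v) (Z ω) := by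
    intro k v ω
    rw [inner_matVec hR, real_inner_comm v, inner_matVec hR]
  have hdiag : ∀ k v, inner ℝ (matVec R (b k)) (matVec R v) = Λ k * inner ℝ (b k) v := by
    intro k v
    rw [key, hb, real_inner_smul_left]
  have hnorm : ∀ v : 𝔼 d, ‖matVec R v‖ ^ 2 = ∑ j, Λ j * inner ℝ (b j) v ^ 2 := by
    intro v
    rw [← real_inner_self_eq_norm_sq, key, ← b.sum_inner_mul_inner]
    refine Finset.sum_congr rfl fun j _ => ?_
    rw [← inner_matVec hS, hb, inner_smul_right, real_inner_comm]
    ring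
  have hbn : ∀ k, ‖matVec R (b k)‖ ^ 2 = Λ k := by
    intro k
    rw [← real_inner_self_eq_norm_sq, hdiag, real_inner_self_eq_norm_sq, b.norm_eq_one]
    ring
  refine ⟨fun k v => ?_, fun k v => ?_, fun k v => ?_, fun k v => ?_⟩
  · rw [integrable_map_measure (by fun_prop) hm.aemeasurable]
    simpa only [Function.comp_def, e] using hZ.integrable_mul _ _
  · rw [integral_map hm.aemeasurable (by fun_prop)]
    simp only [e]
    rw [hZ.integral_mul, hdiag]
  · rw [integrable_map_measure (by fun_prop) hm.aemeasurable]
    simpa only [Function.comp_def, e] using hZ.integrable_mul_sq _ _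
  · rw [integral_map hm.aemeasurable (by fun_prop)]
    simp only [e]
    refine (hZ.integral_mul_sq_le _ _).trans_eq ?_
    rw [hbn, hnorm]
    ring

/-- A unit eigenvector for a simple eigenvalue agrees with the basis vector up to sign. -/
lemma inner_sq_eq_of_eigenvector {S : Matrix (Fin d) (Fin d) ℝ} (hS : S.IsHermitian)
    {b : OrthonormalBasis (Fin d) ℝ (𝔼 d)} {Λ : Fin d → ℝ}
    (hb : ∀ i, matVec S (b i) = Λ i • b i) {i₀ : Fin d} (hgap : ∀ k, k ≠ i₀ → Λ k ≠ Λ i₀)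
    {u : 𝔼 d} (hu : ‖u‖ = 1) (hSu : matVec S u = Λ i₀ • u) (v : 𝔼 d) :
    inner ℝ v u ^ 2 = inner ℝ (b i₀) v ^ 2 := by
  have h0 : ∀ k, k ≠ i₀ → inner ℝ (b k) u = 0 := by
    intro k hk
    have h1 := inner_matVec hS (b k) u
    rw [hSu, hb, inner_smul_right, real_inner_smul_left] at h1
    have h2 : (Λ k - Λ i₀) * inner ℝ (b k) u = 0 := by linarith
    exact (mul_eq_zero.1 h2).resolve_left (sub_ne_zero.2 (hgap k hk))
  have h1 : inner ℝ (b i₀) u ^ 2 = 1 := by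
    have := b.sum_sq_norm_inner_right u
    rw [Finset.sum_eq_single i₀ (fun k _ hk => by rw [h0 k hk]; simp) (by simp), hu] at this
    simpa using this
  have h2 : inner ℝ v u = inner ℝ v (b i₀) * inner ℝ (b i₀) u := by
    rw [← b.sum_inner_mul_inner v u]
    exact Finset.sum_eq_single i₀ (fun k _ hk => by rw [h0 k hk, mul_zero]) (by simp)
  rw [h2, mul_pow, h1, mul_one, real_inner_comm]

end Spectral

/-! ### From normalized iterates to the linear recursion -/

section Tangent

variable {d : ℕ}

/-- An update sends 0 to 0, so a nonzero state at time `n` forces all earlier states to be nonzero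
and no normalization up to then degenerates. -/
lemma iterate_eq_smul_linIter {c β : ℝ} (hc : 0 < c) (u0 : 𝔼 d) (x : ℕ → 𝔼 d) {n : ℕ}
    (h : linIter c β u0 x n ≠ 0) :
    ∃ r : ℝ, 0 < r ∧ OnlinePCA.iterate β u0 x n = r • linIter c β u0 x n := by
  induction n with
  | zero => exact ⟨1, one_pos, (one_smul _ _).symm⟩
  | succ n ih =>
    have hv : linIter c β u0 x n ≠ 0 := by
      intro h0
      apply h
      simp [linIter, linStep, h0]
    obtain ⟨r, hr, hi⟩ := ih hv
    have e : iterate β u0 x n + (β * inner ℝ (x n) (iterate β u0 x n)) • x n =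
        (r * c⁻¹) • linIter c β u0 x (n + 1) := by
      simp only [linIter, linStep]
      rw [hi, inner_smul_right, smul_smul, mul_assoc, inv_mul_cancel₀ hc.ne', mul_one, smul_add,
        smul_smul]
      congr 2
      ring
    have hpos : 0 < ‖(r * c⁻¹) • linIter c β u0 x (n + 1)‖ := by
      rw [norm_pos_iff]
      exact smul_ne_zero (by positivity) h
    refine ⟨‖(r * c⁻¹) • linIter c β u0 x (n + 1)‖⁻¹ * (r * c⁻¹), by positivity, ?_⟩
    rw [OnlinePCA.iterate, proj, e, smul_smul]

lemma tanSq_smul_eq {r : ℝ} (hr : 0 < r) {u v : 𝔼 d} (hu : ‖u‖ = 1) (hvu : inner ℝ v u ≠ 0) :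
    tanSq (r • v) u = ENNReal.ofReal ((‖v‖ ^ 2 - inner ℝ v u ^ 2) / inner ℝ v u ^ 2) := by
  have hv : v ≠ 0 := by
    rintro rfl
    simp at hvu
  have hv0 : 0 < ‖v‖ := norm_pos_iff.2 hv
  have hcos : Real.cos (InnerProductGeometry.angle v u) = inner ℝ v u / ‖v‖ := by
    rw [InnerProductGeometry.cos_angle, hu, mul_one]
  have hcos2 : 0 < Real.cos (InnerProductGeometry.angle v u) ^ 2 := by
    rw [hcos]; positivity
  rw [tanSq, InnerProductGeometry.angle_smul_left_of_pos _ _ hr,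
    ← ENNReal.ofReal_div_of_pos hcos2, Real.sin_sq, hcos]
  congr 1
  field_simp

end Tangent

/-! ### Arithmetic of the rescaled time -/

section RescaledTime

variable {lam1 lam2 β : ℝ}

lemma log_rescale (lam1 lam2 β : ℝ) :
    Real.log ((lam1 ^ 2)⁻¹ * (lam1 - lam2) * β⁻¹) = -Real.log (betaHat lam1 lam2 β) := by
  rw [← Real.log_inv, betaHat]
  congr 1
  rw [mul_inv, mul_inv, inv_inv]

/-- From -log(1 - θ) ≤ θ/(1 - θ). -/
lemma le_mul_rescaledTime {s : ℝ} (hθ : 0 < β * (lam1 - lam2)) (hθ1 : β * (lam1 - lam2) < 1)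
    (hB : 0 < betaHat lam1 lam2 β) (hB1 : betaHat lam1 lam2 β ≤ 1) :
    s * -Real.log (betaHat lam1 lam2 β) * (1 - β * (lam1 - lam2)) ≤
      β * (lam1 - lam2) * rescaledTime lam1 lam2 β s := by
  set θ := β * (lam1 - lam2) with hθd
  have hl : 0 ≤ -Real.log (betaHat lam1 lam2 β) := by linarith [Real.log_nonpos hB.le hB1]
  have h1 : 0 < 1 - θ := by linarith
  have hy : 0 < -Real.log (1 - θ) := by linarith [Real.log_neg h1 (by linarith)]
  have hceil := Nat.le_ceil (s * -Real.log (betaHat lam1 lam2 β) / (-Real.log (1 - θ)))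
  have h2 : -Real.log (1 - θ) * (1 - θ) ≤ θ := by
    have := Real.one_sub_inv_le_log_of_pos h1
    have h3 : (1 - θ) * (1 - θ)⁻¹ = 1 := mul_inv_cancel₀ h1.ne'
    nlinarith
  rw [rescaledTime, log_rescale]
  rw [div_le_iff₀ hy] at hceil
  have h4 : (0 : ℝ) ≤ ⌈s * -Real.log (betaHat lam1 lam2 β) / (-Real.log (1 - θ))⌉₊ :=
    Nat.cast_nonneg _
  calc s * -Real.log (betaHat lam1 lam2 β) * (1 - θ)
      ≤ (⌈s * -Real.log (betaHat lam1 lam2 β) / (-Real.log (1 - θ))⌉₊ * -Real.log (1 - θ))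
        * (1 - θ) := by gcongr
    _ = ⌈s * -Real.log (betaHat lam1 lam2 β) / (-Real.log (1 - θ))⌉₊ *
        (-Real.log (1 - θ) * (1 - θ)) := by ring
    _ ≤ ⌈s * -Real.log (betaHat lam1 lam2 β) / (-Real.log (1 - θ))⌉₊ * θ := by gcongr
    _ = _ := mul_comm _ _

/-- From -log(1 - θ) ≥ θ; the additive θ is the cost of the ceiling. -/
lemma mul_rescaledTime_le {s : ℝ} (hθ : 0 < β * (lam1 - lam2)) (hθ1 : β * (lam1 - lam2) < 1)
    (hB : 0 < betaHat lam1 lam2 β) (hB1 : betaHat lam1 lam2 β ≤ 1) (hs : 0 ≤ s) :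
    β * (lam1 - lam2) * rescaledTime lam1 lam2 β s ≤
      s * -Real.log (betaHat lam1 lam2 β) + β * (lam1 - lam2) := by
  set θ := β * (lam1 - lam2) with hθd
  have hl : 0 ≤ -Real.log (betaHat lam1 lam2 β) := by linarith [Real.log_nonpos hB.le hB1]
  have h1 : 0 < 1 - θ := by linarith
  have hy : θ ≤ -Real.log (1 - θ) := by linarith [Real.log_le_sub_one_of_pos h1]
  rw [rescaledTime, log_rescale]
  have hceil := (Nat.ceil_lt_add_one (a := s * -Real.log (betaHat lam1 lam2 β) /
    (-Real.log (1 - θ))) (div_nonneg (by positivity) (by linarith))).le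
  calc θ * ⌈s * -Real.log (betaHat lam1 lam2 β) / (-Real.log (1 - θ))⌉₊
      ≤ θ * (s * -Real.log (betaHat lam1 lam2 β) / (-Real.log (1 - θ)) + 1) := by gcongr
    _ ≤ θ * (s * -Real.log (betaHat lam1 lam2 β) / θ + 1) := by gcongr
    _ = _ := by field_simp

lemma rescaledTime_mono {s t : ℝ} (hθ : 0 < β * (lam1 - lam2)) (hθ1 : β * (lam1 - lam2) < 1)
    (hB : 0 < betaHat lam1 lam2 β) (hB1 : betaHat lam1 lam2 β ≤ 1) (hst : s ≤ t) :
    rescaledTime lam1 lam2 β s ≤ rescaledTime lam1 lam2 β t := by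
  have hl : 0 ≤ -Real.log (betaHat lam1 lam2 β) := by linarith [Real.log_nonpos hB.le hB1]
  have h1 : 0 < 1 - β * (lam1 - lam2) := by linarith
  have hy : 0 ≤ -Real.log (1 - β * (lam1 - lam2)) := by
    linarith [Real.log_nonpos h1.le (by linarith)]
  rw [rescaledTime, rescaledTime, log_rescale]
  gcongr

lemma decay_pow_le {g : ℝ} (hg : 0 ≤ decay g β) (n : ℕ) :
    decay g β ^ n ≤ Real.exp (-(15 / 8 * (β * g * n))) := by
  calc decay g β ^ n ≤ Real.exp (-(15 / 8 * (β * g))) ^ n := by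
        gcongr
        exact Real.one_sub_le_exp_neg _
    _ = _ := by
        rw [← Real.exp_nat_mul]
        congr 1
        ring

/-- The burn-in length 3/5 is chosen so that 3/5 · 15/8 = 9/8 exceeds 1. -/
lemma decay_pow_rescaledTime_le (hθ : 0 < β * (lam1 - lam2)) (hθ1 : β * (lam1 - lam2) ≤ 1 / 1024)
    (hB : 0 < betaHat lam1 lam2 β) (hB1 : betaHat lam1 lam2 β ≤ 1) :
    decay (lam1 - lam2) β ^ rescaledTime lam1 lam2 β (3 / 5) ≤ betaHat lam1 lam2 β := by
  have hl : 0 ≤ -Real.log (betaHat lam1 lam2 β) := by linarith [Real.log_nonpos hB.le hB1]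
  have h1 := le_mul_rescaledTime (s := 3 / 5) hθ (by linarith) hB hB1
  refine (decay_pow_le (by unfold decay; linarith) _).trans ?_
  conv_rhs => rw [← Real.exp_log hB]
  apply Real.exp_le_exp.2
  nlinarith [mul_nonneg hl (by linarith : 0 ≤ 1 / 1024 - β * (lam1 - lam2))]

/-- What remains after the burn-in has (2 - 3/5) · 15/8 = 21/8, more than 5/2. The ceiling error is
absorbed because -log of `betaHat` is at least 1. -/
lemma decay_pow_sub_le (hθ : 0 < β * (lam1 - lam2)) (hθ1 : β * (lam1 - lam2) ≤ 1 / 1024)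
    (hB : 0 < betaHat lam1 lam2 β) (hB1 : betaHat lam1 lam2 β ≤ 1 / 1024) {n : ℕ}
    (hn : rescaledTime lam1 lam2 β 2 ≤ n) :
    decay (lam1 - lam2) β ^ (n - rescaledTime lam1 lam2 β (3 / 5)) ≤
      betaHat lam1 lam2 β ^ (5 / 2 : ℝ) := by
  have hl : 1 ≤ -Real.log (betaHat lam1 lam2 β) := by
    have : Real.log (betaHat lam1 lam2 β) ≤ Real.log (Real.exp (-1)) := by
      apply Real.log_le_log hB
      have := Real.add_one_le_exp (1 : ℝ)
      have h3 : Real.exp 1 ≤ 3 := Real.exp_one_lt_three.le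
      rw [Real.exp_neg]
      have : (3 : ℝ)⁻¹ ≤ (Real.exp 1)⁻¹ := by gcongr
      linarith
    rw [Real.log_exp] at this
    linarith
  have hmn : rescaledTime lam1 lam2 β (3 / 5) ≤ n :=
    (rescaledTime_mono hθ (by linarith) hB (by linarith) (by norm_num)).trans hn
  have h1 := le_mul_rescaledTime (s := 2) hθ (by linarith) hB (by linarith)
  have h2 := mul_rescaledTime_le (s := 3 / 5) hθ (by linarith) hB (by linarith) (by norm_num)
  have h3 : β * (lam1 - lam2) * rescaledTime lam1 lam2 β 2 ≤ β * (lam1 - lam2) * n := by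
    have : (rescaledTime lam1 lam2 β 2 : ℝ) ≤ n := by exact_mod_cast hn
    gcongr
  refine (decay_pow_le (by unfold decay; linarith) _).trans ?_
  rw [Real.rpow_def_of_pos hB]
  apply Real.exp_le_exp.2
  rw [Nat.cast_sub hmn]
  nlinarith [mul_nonneg (by linarith : 0 ≤ -Real.log (betaHat lam1 lam2 β))
    (by linarith : 0 ≤ 1 / 1024 - β * (lam1 - lam2))]

/-- The left side is β²λ₁²N, the variance scale of the leading coordinate over the whole run. It is
of order B log(1/B), and log(1/B) ≤ 2B^{-1/2}. -/
lemma betaHat_mul_rescaledTime_le (hθ : 0 < β * (lam1 - lam2)) (hθ1 : β * (lam1 - lam2) ≤ 1 / 1024)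
    (hB : 0 < betaHat lam1 lam2 β) (hB1 : betaHat lam1 lam2 β ≤ 1) :
    betaHat lam1 lam2 β * (β * (lam1 - lam2) * rescaledTime lam1 lam2 β 3) ≤
      7 * √(betaHat lam1 lam2 β) := by
  have h1 := mul_rescaledTime_le (s := 3) hθ (by linarith) hB hB1 (by norm_num)
  set B := betaHat lam1 lam2 β
  have hr : 0 < √B := Real.sqrt_pos.2 hB
  have hsq : √B * √B = B := Real.mul_self_sqrt hB.le
  have hr1 : √B ≤ 1 := Real.sqrt_le_one.2 hB1
  have h2 : -Real.log B ≤ 2 * (√B)⁻¹ := by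
    have h3 := Real.log_le_sub_one_of_pos (inv_pos.2 hr)
    rw [Real.log_inv, Real.log_sqrt hB.le] at h3
    linarith
  have h3 : B * -Real.log B ≤ 2 * √B := by
    calc B * -Real.log B ≤ B * (2 * (√B)⁻¹) := by gcongr
      _ = 2 * (√B * √B) * (√B)⁻¹ := by rw [hsq]; ring
      _ = _ := by field_simp
  calc B * (β * (lam1 - lam2) * rescaledTime lam1 lam2 β 3)
      ≤ B * (3 * -Real.log B + β * (lam1 - lam2)) := by gcongr
    _ ≤ _ := by nlinarith

end RescaledTime

lemma div_sq_le_of_close {a t V : ℝ} (hV : 0 ≤ V) (ht : t ≠ 0) (h : (a - t) ^ 2 ≤ t ^ 2 / 4) :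
    V / a ^ 2 ≤ 4 * ((t ^ 2)⁻¹ * V) := by
  have h2 : 0 < t ^ 2 := by positivity
  have h4 : t ^ 2 / 4 ≤ a ^ 2 := by
    have h5 : |a - t| ≤ |t| / 2 := by
      rw [← abs_two, ← abs_div, ← sq_le_sq, div_pow]
      linarith
    have h6 : |t| / 2 ≤ |a| := by
      have := abs_sub_abs_le_abs_sub t a
      rw [abs_sub_comm] at this
      linarith
    have h7 := pow_le_pow_left₀ (by positivity) h6 2
    rw [div_pow, sq_abs, sq_abs] at h7
    linarith
  calc V / a ^ 2 ≤ V / (t ^ 2 / 4) := by gcongr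
    _ = _ := by field_simp

/-! ### Burn-in and probability of the stable event -/

section Convergence

variable {d : ℕ} {Ω : Type*} [mΩ : MeasurableSpace Ω] {P : Measure Ω}
  {μ : Measure (𝔼 d)} {g c β : ℝ} {F : ℕ → MeasurableSpace Ω} {X v : ℕ → Ω → 𝔼 d}
  {b : OrthonormalBasis (Fin d) ℝ (𝔼 d)} {Λ : Fin d → ℝ} {i₀ : Fin d}

/-- On the stable event, the squared tangent is controlled by the weighted energy of the
nonleading coordinates. -/
lemma lintegral_stable_ratio_le (hv : ∀ n, Measurable (v n)) {L : ℝ} {n N : ℕ} (hn : n ≤ N)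
    (hS : MeasurableSet (stable b i₀ L v N)) (hw : Measurable (weight b i₀ L v n)) :
    ∫⁻ ω in stable b i₀ L v N,
        ENNReal.ofReal ((‖v n ω‖ ^ 2 - inner ℝ (b i₀) (v n ω) ^ 2) / inner ℝ (b i₀) (v n ω) ^ 2) ∂P
      ≤ ENNReal.ofReal 4 *
        ∑ k ∈ Finset.univ.erase i₀, moment P b (weight b i₀ L v n) (v n) k := by
  have hvn := hv n
  unfold moment
  rw [← lintegral_finsetSum _ (fun k _ => by fun_prop), ← lintegral_const_mul _ (by fun_prop),
    ← lintegral_indicator hS]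
  refine lintegral_mono fun ω => ?_
  by_cases hω : ω ∈ stable b i₀ L v N
  · have hωn : ω ∈ stable b i₀ L v n := stable_anti hn hω
    rw [Set.indicator_of_mem hω, weight, Set.indicator_of_mem hωn, ← Finset.mul_sum,
      ← ENNReal.ofReal_sum_of_nonneg fun _ _ => sq_nonneg _, ← ENNReal.ofReal_mul (by positivity),
      ← ENNReal.ofReal_mul (by positivity)]
    apply ENNReal.ofReal_le_ofReal
    have h1 : ‖v n ω‖ ^ 2 - inner ℝ (b i₀) (v n ω) ^ 2 =
        ∑ k ∈ Finset.univ.erase i₀, inner ℝ (b k) (v n ω) ^ 2 := by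
      rw [← b.sum_sq_norm_inner_right, ← Finset.add_sum_erase _ _ (Finset.mem_univ i₀)]
      simp
    rw [h1]
    exact div_sq_le_of_close (Finset.sum_nonneg fun _ _ => sq_nonneg _) hω.1.1 (hωn.2 n le_rfl)
  · rw [Set.indicator_of_notMem hω]
    exact zero_le

variable [IsProbabilityMeasure P]

/-- The stable event started at time `m` has high probability, when the samples are independent
of a uniform starting point. -/
lemma measure_compl_stable_le (hd : 2 ≤ d) (hμ : HasMoments μ b Λ)
    (hs : IsSmallStep Λ i₀ g β c) {u0 : Ω → 𝔼 d} (hX : ∀ n, Measurable (X n))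
    (hu : Measurable u0) (hlawX : ∀ n, P.map (X n) = μ) (hlaw : P.map u0 = uniformSphere d)
    (hind : iIndepFun X P) (hind0 : IndepFun u0 (fun ω n => X n ω) P) {m N : ℕ} {L s : ℝ}
    (hL : 0 < L) (hs0 : 0 < s) (hm : 64 * (β ^ 2 * Λ i₀ ^ 2 * m) ≤ 1)
    {p₁ p₂ : ℝ} (hp₁ : 256 * (β ^ 2 * Λ i₀ ^ 2 * m) ≤ p₁)
    (hp₂ : 2 * decay g β ^ m + 64 * (d * (Λ i₀ ^ 2 * g⁻¹ * β)) ≤ p₂ * (L * s ^ 2))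
    (hp₂0 : 0 ≤ p₂) :
    P (stable b i₀ L (fun n ω => linIter c β (u0 ω) (fun i => X i ω) (m + n)) N)ᶜ ≤
      ENNReal.ofReal (p₁ + 2 * s * √d + p₂ +
        (256 * (β ^ 2 * Λ i₀ ^ 2 * N) + 128 * ((Λ i₀ ^ 2 * g⁻¹ * β) * L))) := by
  set v : ℕ → Ω → 𝔼 d := fun n ω => linIter c β (u0 ω) (fun i => X i ω) n with hv
  -- Auxiliary recursion on the same data, started at the leading eigenvector; it certifies that the
  -- product of updates does not shrink that direction.
  set e : ℕ → Ω → 𝔼 d := fun n ω => linIter c β (b i₀) (fun i => X i ω) n with he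
  have hpe : IsLinProcess P μ c β (past u0 X) X e :=
    isLinProcess_linIter hX hu hlawX hind hind0 c β (y := fun _ => b i₀) measurable_const
  have hpv : IsLinProcess P μ c β (past u0 X) X v :=
    isLinProcess_linIter hX hu hlawX hind hind0 c β (y := u0)
      (measurable_fst.comp (comap_measurable _))
  have hps := hpv.shift m
  have hbn : ‖b i₀‖ = 1 := b.norm_eq_one i₀
  have hgood : goodStart b i₀ 0 (e 0) = Set.univ := by
    refine Set.eq_univ_of_forall fun ω => ⟨?_, ?_⟩
    · simp only [he, linIter]
      rw [real_inner_self_eq_norm_sq, hbn]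
      norm_num
    · rw [zero_mul]
      apply le_of_eq
      refine Finset.sum_eq_zero fun k hk => ?_
      simp only [he, linIter]
      rw [b.inner_eq_zero (Finset.ne_of_mem_erase hk)]
      norm_num
  have hE1 := hpe.measure_goodStart_diff_stable_le hμ hs le_rfl m
  rw [hgood, mul_zero, mul_zero, add_zero] at hE1
  have hE2 := measure_small_top_le hd hX hu hlaw hind0 c β m hbn hs0.le
  have hE4 := hps.measure_goodStart_diff_stable_le hμ hs hL.le N
  have hunit : ∀ᵐ ω ∂P, ‖v 0 ω‖ = 1 := by
    have h1 : ∀ᵐ u ∂(P.map u0), ‖u‖ = 1 := by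
      rw [hlaw]
      exact uniformSphere_compl_sphere
    exact ae_of_ae_map hu.aemeasurable h1
  have hE3 : P {ω | L * s ^ 2 ≤ ∑ k ∈ Finset.univ.erase i₀, inner ℝ (b k) (v m ω) ^ 2} ≤
      ENNReal.ofReal p₂ := by
    have h1 := hpv.sum_moment_one_le hμ hs hunit hm
    have hvm := hpv.measurable m
    have hpos : 0 < L * s ^ 2 := by positivity
    have h2 := mul_meas_ge_le_lintegral (μ := P)
      (f := fun ω => ENNReal.ofReal (∑ k ∈ Finset.univ.erase i₀, inner ℝ (b k) (v m ω) ^ 2))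
      (by fun_prop) (ENNReal.ofReal (L * s ^ 2))
    have h3 : ∫⁻ ω, ENNReal.ofReal (∑ k ∈ Finset.univ.erase i₀, inner ℝ (b k) (v m ω) ^ 2) ∂P =
        ∑ k ∈ Finset.univ.erase i₀, moment P b (fun _ => 1) (v m) k := by
      unfold moment
      rw [← lintegral_finsetSum _ (fun k _ => by fun_prop)]
      refine lintegral_congr fun ω => ?_
      simp only [one_mul]
      exact ENNReal.ofReal_sum_of_nonneg fun _ _ => sq_nonneg _
    rw [h3] at h2
    have h4 := (h2.trans h1).trans (ENNReal.ofReal_le_ofReal hp₂)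
    rw [mul_comm p₂, ENNReal.ofReal_mul hpos.le,
      ENNReal.mul_le_mul_iff_right (by simpa using hpos) ENNReal.ofReal_ne_top] at h4
    refine le_trans (measure_mono fun ω hω => ?_) h4
    exact ENNReal.ofReal_le_ofReal hω
  -- Four ways to fail: the auxiliary recursion drifts, the leading coordinate after burn-in is
  -- below `s`, the nonleading energy is at least `L * s ^ 2`, or a good start later becomes
  -- unstable.
  have hcover : (stable b i₀ L (fun n => v (m + n)) N)ᶜ ⊆
      (((Set.univ \ stable b i₀ 0 e m) ∪
        {ω | 1 / 2 ≤ inner ℝ (b i₀) (e m ω) ∧ |inner ℝ (b i₀) (v m ω)| < s}) ∪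
        {ω | L * s ^ 2 ≤ ∑ k ∈ Finset.univ.erase i₀, inner ℝ (b k) (v m ω) ^ 2}) ∪
        (goodStart b i₀ L (v (m + 0)) \ stable b i₀ L (fun n => v (m + n)) N) := by
    intro ω hω
    by_cases h1 : ω ∈ stable b i₀ 0 e m
    swap
    · exact Or.inl (Or.inl (Or.inl ⟨trivial, h1⟩))
    have h2 : 1 / 2 ≤ inner ℝ (b i₀) (e m ω) := by
      have h3 := h1.2 m le_rfl
      have h4 : inner ℝ (b i₀) (e 0 ω) = 1 := by
        simp only [he, linIter]
        rw [real_inner_self_eq_norm_sq, hbn]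
        norm_num
      rw [h4] at h3
      nlinarith
    by_cases h3 : |inner ℝ (b i₀) (v m ω)| < s
    · exact Or.inl (Or.inl (Or.inr ⟨h2, h3⟩))
    by_cases h4 : L * s ^ 2 ≤ ∑ k ∈ Finset.univ.erase i₀, inner ℝ (b k) (v m ω) ^ 2
    · exact Or.inl (Or.inr h4)
    refine Or.inr ⟨⟨?_, ?_⟩, hω⟩
    · intro h0
      rw [add_zero] at h0
      rw [h0, abs_zero] at h3
      exact h3 hs0
    · rw [add_zero]
      push Not at h3 h4
      have h5 := pow_le_pow_left₀ hs0.le h3 2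
      rw [sq_abs] at h5
      exact h4.le.trans (mul_le_mul_of_nonneg_left h5 hL.le)
  have hrate := hs.rate_pos
  have hη : 0 ≤ β ^ 2 * Λ i₀ ^ 2 := by positivity
  have hp₁0 : 0 ≤ p₁ := le_trans (by positivity) hp₁
  refine (measure_mono hcover).trans ((measure_union_le _ _).trans ?_)
  rw [ENNReal.ofReal_add (by positivity) (by positivity),
    ENNReal.ofReal_add (by positivity) hp₂0, ENNReal.ofReal_add hp₁0 (by positivity)]
  refine add_le_add ((measure_union_le _ _).trans (add_le_add ((measure_union_le _ _).trans
    (add_le_add ?_ hE2)) hE3)) hE4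
  exact hE1.trans (ENNReal.ofReal_le_ofReal hp₁)

end Convergence

/-! ### The event and the tangent bound -/

section Main

variable {d : ℕ} {Ω : Type*} [mΩ : MeasurableSpace Ω] {P : Measure Ω} [IsProbabilityMeasure P]
  {μ : Measure (𝔼 d)} {lam1 lam2 c β : ℝ} {X : ℕ → Ω → 𝔼 d}
  {b : OrthonormalBasis (Fin d) ℝ (𝔼 d)} {Λ : Fin d → ℝ} {i₀ : Fin d}

lemma exists_event (hd : 2 ≤ d) (hμ : HasMoments μ b Λ)
    (hs : IsSmallStep Λ i₀ (lam1 - lam2) β c) (htop : Λ i₀ = lam1) {u0 : Ω → 𝔼 d}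
    (hX : ∀ n, Measurable (X n)) (hu : Measurable u0) (hlawX : ∀ n, P.map (X n) = μ)
    (hlaw : P.map u0 = uniformSphere d) (hind : iIndepFun X P)
    (hind0 : IndepFun u0 (fun ω n => X n ω) P) {ustar : 𝔼 d} (hustar : ‖ustar‖ = 1)
    (hinner : ∀ v, inner ℝ v ustar ^ 2 = inner ℝ (b i₀) v ^ 2) {δ : ℝ} (hδ : 0 < δ)
    (hδ1 : δ ≤ 1 / 2) (hB : d * betaHat lam1 lam2 β ≤ 1 / 2 ^ 40 * δ ^ 2) :
    ∃ A : Set Ω, MeasurableSet A ∧ P Aᶜ ≤ ENNReal.ofReal (2 * δ) ∧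
      ∀ n : ℕ, rescaledTime lam1 lam2 β 2 ≤ n → n ≤ rescaledTime lam1 lam2 β 3 →
        ∫⁻ ω in A, tanSq (OnlinePCA.iterate β (u0 ω) (fun m => X m ω) n) ustar ∂P ≤
          ENNReal.ofReal (betaHat lam1 lam2 β ^ (3 / 2 : ℝ) +
            4 * ∑ k ∈ Finset.univ.erase i₀, noiseLevel Λ i₀ β k) := by
  set m := rescaledTime lam1 lam2 β (3 / 5) with hm
  set N := rescaledTime lam1 lam2 β 3 with hN
  set B := betaHat lam1 lam2 β with hBdef
  have hBe : Λ i₀ ^ 2 * (lam1 - lam2)⁻¹ * β = B := by rw [htop, hBdef, betaHat]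
  have hB0 : 0 < B := by rw [← hBe]; exact hs.rate_pos
  have hBle : 1024 * B ≤ 1 := by rw [← hBe]; exact hs.rate_le
  have hθ : 0 < β * (lam1 - lam2) := mul_pos hs.step_pos hs.gap_pos
  have hθB : β * (lam1 - lam2) ≤ B := by rw [← hBe]; exact hs.step_mul_gap_le
  have hd1 : (1 : ℝ) ≤ d := by exact_mod_cast (by omega : 1 ≤ d)
  have hBδ : B ≤ 1 / 2 ^ 40 * δ ^ 2 := by nlinarith
  have hsqrt : √B ≤ 1 / 2 ^ 20 * δ := by
    apply Real.sqrt_le_iff.2 ⟨by positivity, ?_⟩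
    refine hBδ.trans_eq ?_
    ring
  have hηN : β ^ 2 * Λ i₀ ^ 2 * N ≤ 7 * (1 / 2 ^ 20 * δ) := by
    rw [hs.sq_eq, hBe, mul_assoc]
    refine (betaHat_mul_rescaledTime_le hθ (by linarith) hB0 (by linarith)).trans ?_
    gcongr
  have hmN : m ≤ N := rescaledTime_mono hθ (by linarith) hB0 (by linarith) (by norm_num)
  have hη0 : 0 ≤ β ^ 2 * Λ i₀ ^ 2 := by positivity
  have hηm : β ^ 2 * Λ i₀ ^ 2 * m ≤ 7 * (1 / 2 ^ 20 * δ) := by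
    refine le_trans ?_ hηN
    gcongr
  have hηNm : β ^ 2 * Λ i₀ ^ 2 * (N - m : ℕ) ≤ 7 * (1 / 2 ^ 20 * δ) := by
    refine le_trans ?_ hηN
    gcongr
    exact Nat.sub_le _ _
  have hdecay : decay (lam1 - lam2) β ^ m ≤ B :=
    decay_pow_rescaledTime_le hθ (by linarith) hB0 (by linarith)
  -- The largest ratio, up to a constant, for which the instability probability `128 * (B * L)` is a
  -- fraction of δ.
  set L := δ / (1024 * B) with hL
  -- Makes the anticoncentration bound `2 * s * √d` equal to δ/2.
  set s := δ / (4 * √d) with hsdef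
  have hL0 : 0 < L := by positivity
  have hsd : 0 < √(d : ℝ) := Real.sqrt_pos.2 (by linarith)
  have hs0 : 0 < s := by positivity
  have hLs : δ / 8 * (L * s ^ 2) = δ ^ 4 / (2 ^ 17 * (d * B)) := by
    have h3 : s ^ 2 = δ ^ 2 / (16 * d) := by
      rw [hsdef, div_pow, mul_pow, Real.sq_sqrt (by linarith)]
      norm_num
    rw [h3, hL]
    field_simp
    norm_num
  set v : ℕ → Ω → 𝔼 d := fun n ω => linIter c β (u0 ω) (fun i => X i ω) n with hv
  have hpv : IsLinProcess P μ c β (past u0 X) X v :=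
    isLinProcess_linIter hX hu hlawX hind hind0 c β (y := u0)
      (measurable_fst.comp (comap_measurable _))
  have hps := hpv.shift m
  have hprob := measure_compl_stable_le (N := N - m) (L := L) (s := s) (m := m) (p₁ := δ / 8)
    (p₂ := δ / 8) hd hμ hs hX hu hlawX hlaw hind hind0 hL0 hs0 (by linarith) (by linarith) (by
      rw [hBe, hLs, le_div_iff₀ (by positivity)]
      have h3 : B ≤ d * B := by nlinarith
      have h4 : 0 ≤ d * B := by positivity
      calc (2 * decay (lam1 - lam2) β ^ m + 64 * (d * B)) * (2 ^ 17 * (d * B))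
          ≤ (2 * (d * B) + 64 * (d * B)) * (2 ^ 17 * (d * B)) := by
            gcongr
            exact hdecay.trans h3
        _ = 66 * 2 ^ 17 * (d * B) ^ 2 := by ring
        _ ≤ 66 * 2 ^ 17 * (1 / 2 ^ 40 * δ ^ 2) ^ 2 := by gcongr
        _ ≤ δ ^ 4 := by
            have : 0 ≤ δ ^ 4 := by positivity
            nlinarith) (by positivity)
  set w : ℕ → Ω → 𝔼 d := fun n => v (m + n) with hw
  refine ⟨stable b i₀ L w (N - m), hps.le _ _ (hps.measurableSet_stable L (N - m)), ?_, ?_⟩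
  · refine hprob.trans (ENNReal.ofReal_le_ofReal ?_)
    have h3 : 2 * s * √d = δ / 2 := by
      rw [hsdef]; field_simp; norm_num
    have h4 : B * L = δ / 1024 := by
      rw [hL]; field_simp
    rw [h3, hBe, h4]
    linarith
  · intro n hn2 hn3
    have hmn : m ≤ n := (rescaledTime_mono hθ (by linarith) hB0 (by linarith) (by norm_num)).trans hn2
    have hSm := hps.le _ _ (hps.measurableSet_stable (b := b) (i₀ := i₀) L (N - m))
    have e1 : ∫⁻ ω in stable b i₀ L w (N - m),
          tanSq (OnlinePCA.iterate β (u0 ω) (fun m => X m ω) n) ustar ∂P =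
        ∫⁻ ω in stable b i₀ L w (N - m), ENNReal.ofReal
          ((‖w (n - m) ω‖ ^ 2 - inner ℝ (b i₀) (w (n - m) ω) ^ 2) /
            inner ℝ (b i₀) (w (n - m) ω) ^ 2) ∂P := by
      refine setLIntegral_congr_fun hSm fun ω hω => ?_
      have hwn : w (n - m) ω = linIter c β (u0 ω) (fun i => X i ω) n := by
        simp only [hw, hv]
        rw [Nat.add_sub_cancel' hmn]
      -- On the stable event the leading coordinate keeps at least half its starting size, so the
      -- tangent is finite there.
      have hne : inner ℝ (b i₀) (w (n - m) ω) ≠ 0 := by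
        intro h0
        have h3 := hω.2 (n - m) (by omega)
        have h4 : 0 < inner ℝ (b i₀) (w 0 ω) ^ 2 := by have := hω.1.1; positivity
        rw [h0] at h3
        nlinarith
      rw [hwn] at hne ⊢
      have hne' : linIter c β (u0 ω) (fun i => X i ω) n ≠ 0 := by
        intro h0
        rw [h0, inner_zero_right] at hne
        exact hne rfl
      obtain ⟨r, hr, hit⟩ := iterate_eq_smul_linIter hs.factor_pos (u0 ω) (fun i => X i ω) hne'
        (β := β)
      have hne2 : inner ℝ (linIter c β (u0 ω) (fun i => X i ω) n) ustar ≠ 0 := by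
        have := hinner (linIter c β (u0 ω) (fun i => X i ω) n)
        intro h0
        rw [h0] at this
        exact hne (by simpa using this.symm)
      rw [hit, tanSq_smul_eq hr hustar hne2, hinner]
    rw [e1]
    have hww : Measurable (weight b i₀ L w (n - m)) :=
      (hps.measurable_weight L (n - m)).mono (hps.le _) le_rfl
    refine (lintegral_stable_ratio_le hps.measurable (by omega) hSm hww).trans ?_
    have h5 := hps.sum_moment_le hμ hs (fun n => hps.measurable_weight (b := b) (i₀ := i₀) L n)
      weight_anti hL0.le (moment_weight_start_le (hps.measurable 0)) (n := n - m)
      (fun j _ => moment_weight_top_le j)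
    refine (mul_le_mul_right h5 _).trans ?_
    rw [← ENNReal.ofReal_mul (by norm_num)]
    apply ENNReal.ofReal_le_ofReal
    have h6 := decay_pow_sub_le hθ (by linarith) hB0 (by linarith) hn2
    have h7 : B ^ (5 / 2 : ℝ) = B * B ^ (3 / 2 : ℝ) := by
      rw [show (5 / 2 : ℝ) = 1 + 3 / 2 by norm_num, Real.rpow_add hB0, Real.rpow_one]
    have h8 : 0 ≤ B ^ (3 / 2 : ℝ) := by positivity
    -- One factor `B` of the decay `B ^ (5 / 2)` cancels the 1/B in `L`.
    have h9 : 4 * (2 * L * decay (lam1 - lam2) β ^ (n - m)) ≤ B ^ (3 / 2 : ℝ) := by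
      calc 4 * (2 * L * decay (lam1 - lam2) β ^ (n - m))
          ≤ 4 * (2 * L * (B * B ^ (3 / 2 : ℝ))) := by
            rw [← h7]
            gcongr
        _ = 8 / 1024 * δ * B ^ (3 / 2 : ℝ) := by
            rw [hL]; field_simp; norm_num
        _ ≤ 1 * B ^ (3 / 2 : ℝ) := by
            gcongr
            linarith
        _ = _ := one_mul _
    linarith

/-- Reindexing of a sum over the nonleading coordinates. -/
lemma sum_erase_eq_sum_Icc {d : ℕ} (hd : 0 < d) (f : ℕ → ℝ) :
    ∑ k ∈ Finset.univ.erase (⟨0, hd⟩ : Fin d), f (k + 1) = ∑ k ∈ Finset.Icc 2 d, f k := by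
  refine Finset.sum_bij (fun k _ => (k : ℕ) + 1) ?_ ?_ ?_ ?_
  · intro k hk
    have h1 := Finset.ne_of_mem_erase hk
    have h2 : (k : ℕ) ≠ 0 := fun h => h1 (Fin.ext h)
    simp only [Finset.mem_Icc]
    omega
  · intro k _ l _ h
    exact Fin.ext (by omega)
  · intro k hk
    rw [Finset.mem_Icc] at hk
    refine ⟨⟨k - 1, by omega⟩, ?_, ?_⟩
    · simp only [Finset.mem_erase, ne_eq, Fin.mk.injEq, Finset.mem_univ, and_true]
      omega
    · simp only
      omega
  · intro k _
    rfl

lemma eigval_anti {S : Matrix (Fin d) (Fin d) ℝ} (hS : S.IsHermitian) {j k : ℕ} (hj : 1 ≤ j)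
    (hjk : j ≤ k) (hk : k ≤ d) : eigval hS k ≤ eigval hS j := by
  rw [eigval, eigval, dif_pos ⟨by omega, hk⟩, dif_pos ⟨hj, by omega⟩]
  apply hS.eigenvalues₀_antitone
  rw [Fin.mk_le_mk]
  omega

end Main

end OnlinePCA

end

/-! ### The theorem -/

theorem theorem2 :
    ∃ b₂ C₃ C₄ : ℝ, 0 < b₂ ∧ 0 < C₃ ∧ 0 < C₄ ∧
      ∀ (d : ℕ), 2 ≤ d →
      -- the covariance matrix, its symmetric square root, its eigengap, its principal component
      ∀ (S R : Matrix (Fin d) (Fin d) ℝ) (hS : S.PosSemidef), R.PosSemidef → R * R = S →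
      OnlinePCA.eigval hS.isHermitian 2 < OnlinePCA.eigval hS.isHermitian 1 →
      ∀ (ustar : EuclideanSpace ℝ (Fin d)), ‖ustar‖ = 1 →
      OnlinePCA.matVec S ustar = OnlinePCA.eigval hS.isHermitian 1 • ustar →
      -- the random vector `Z`
      ∀ {Ω' : Type*} [MeasurableSpace Ω'] (P' : Measure Ω') [IsProbabilityMeasure P']
        (Z : Ω' → EuclideanSpace ℝ (Fin d)), OnlinePCA.IsIsotropicSubgaussian P' Z →
      -- i.i.d. realizations of `Σ^{1/2} Z`, and an independent uniform initialization
      ∀ {Ω : Type*} [MeasurableSpace Ω] (P : Measure Ω) [IsProbabilityMeasure P]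
        (X : ℕ → Ω → EuclideanSpace ℝ (Fin d)) (u0 : Ω → EuclideanSpace ℝ (Fin d)),
      (∀ n, Measurable (X n)) → Measurable u0 →
      (∀ n, IdentDistrib (X n) (fun ω' => OnlinePCA.matVec R (Z ω')) P P') →
      iIndepFun X P →
      HasLaw u0 (OnlinePCA.uniformSphere d) P →
      IndepFun u0 (fun ω n => X n ω) P →
      ∀ (lam : ℕ → ℝ), lam = OnlinePCA.eigval hS.isHermitian →
      ∀ (ε β δ : ℝ), 0 < ε → ε < 1 / 8 → 0 < β → 0 < δ →
      (d : ℝ) * OnlinePCA.betaHat (lam 1) (lam 2) β ^ (1 - 2 * ε) ≤ b₂ * δ ^ 2 →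
      4 * (d : ℝ) * (OnlinePCA.rescaledTime (lam 1) (lam 2) β 2 : ℝ) *
          Real.exp (-C₃ * OnlinePCA.betaHat (lam 1) (lam 2) β ^ (-2 * ε)) ≤ δ →
      ∃ A : Set Ω, MeasurableSet A ∧ 1 - 2 * δ ≤ P.real A ∧
        ∀ n : ℕ, OnlinePCA.rescaledTime (lam 1) (lam 2) β 2 ≤ n →
          n ≤ OnlinePCA.rescaledTime (lam 1) (lam 2) β 3 →
          ∫⁻ ω in A, OnlinePCA.tanSq
              (OnlinePCA.iterate β (u0 ω) (fun m => X m ω) n) ustar ∂P ≤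
            ENNReal.ofReal
              (C₄ * δ ^ (-4 : ℤ) * (d : ℝ) ^ 2 * (1 - β * (lam 1 - lam 2)) ^ (2 * n) +
                C₄ * ∑ k ∈ Finset.Icc 2 d,
                  (lam 1 * lam k +
                      lam 1 ^ 2 *
                        OnlinePCA.betaHat (lam 1) (lam 2) β ^ (0.5 - 4 * ε : ℝ)) /
                    (lam 1 - lam k) * β) := by
  -- 256 is 4, the cost of halving the leading coordinate, times the 64 of `noiseLevel`.
  refine ⟨1 / 2 ^ 40, 1, 256, by norm_num, by norm_num, by norm_num, ?_⟩
  intro d hd S R hS hR hRS hgap ustar hu hSu Ω' _ P' _ Z hZ Ω _ P _ X u0 hX hu0 hid hind hlaw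
    hind0 lam hlam ε β δ hε hε8 hβ hδ hsmall _
  obtain ⟨b, hb⟩ := OnlinePCA.exists_eigenbasis hS.isHermitian
  have hd0 : 0 < d := by omega
  set i₀ : Fin d := ⟨0, hd0⟩ with hi₀
  have hnonneg : ∀ k, 1 ≤ k → k ≤ d → 0 ≤ lam k := by
    intro k hk1 hkd
    have h1 := hb ⟨k - 1, by omega⟩
    have h2 : OnlinePCA.eigval hS.isHermitian k = ‖OnlinePCA.matVec R (b ⟨k - 1, by omega⟩)‖ ^ 2 := by
      rw [← real_inner_self_eq_norm_sq, OnlinePCA.inner_matVec hR.isHermitian,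
        OnlinePCA.matVec_matVec, hRS, h1, real_inner_smul_left, real_inner_self_eq_norm_sq,
        b.norm_eq_one]
      simp [Nat.sub_add_cancel hk1]
    rw [hlam, h2]
    positivity
  have hanti : ∀ k, 2 ≤ k → k ≤ d → lam k ≤ lam 2 := fun k hk2 hkd => by
    rw [hlam]
    exact OnlinePCA.eigval_anti hS.isHermitian (by norm_num) hk2 hkd
  rw [← hlam] at hgap hSu hb
  have hg : 0 < lam 1 - lam 2 := sub_pos.2 hgap
  have hlam2 : 0 ≤ lam 2 := hnonneg 2 (by norm_num) hd
  have hlam1 : 0 < lam 1 := by linarith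
  have hterm : ∀ k ∈ Finset.Icc 2 d, 0 < lam 1 - lam k ∧ 0 ≤ lam k := by
    intro k hk
    rw [Finset.mem_Icc] at hk
    exact ⟨by linarith [hanti k hk.1 hk.2], hnonneg k (by omega) hk.2⟩
  set B := OnlinePCA.betaHat (lam 1) (lam 2) β with hBdef
  have hB0 : 0 < B := by
    rw [hBdef, OnlinePCA.betaHat]
    positivity
  -- For δ > 1/2 the required probability is negative and the empty event works.
  rcases lt_or_ge (1 / 2) δ with hδ2 | hδ2
  · refine ⟨∅, MeasurableSet.empty, ?_, fun n _ _ => ?_⟩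
    · rw [measureReal_empty]
      linarith
    · simp
  have hd2 : (2 : ℝ) ≤ d := by exact_mod_cast hd
  have hBlt : B < 1 := by
    by_contra hcon
    have h1 : 1 ≤ B ^ (1 - 2 * ε) := Real.one_le_rpow (by linarith) (by linarith)
    nlinarith
  have hBd : d * B ≤ 1 / 2 ^ 40 * δ ^ 2 := by
    refine le_trans ?_ hsmall
    have : B ≤ B ^ (1 - 2 * ε) := by
      conv_lhs => rw [← Real.rpow_one B]
      exact Real.rpow_le_rpow_of_exponent_ge hB0 hBlt.le (by linarith)
    gcongr
  have hstep : OnlinePCA.IsSmallStep (fun i : Fin d => lam (i + 1)) i₀ (lam 1 - lam 2) β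
      (1 + β * lam 1)⁻¹ := by
    refine ⟨fun k => hnonneg _ (by omega) (by omega), hg, ?_, fun k hk => ?_, hβ, ?_, ?_⟩
    · simp only [hi₀, zero_add]
      linarith
    · have h2 : (k : ℕ) ≠ 0 := fun h => hk (Fin.ext h)
      have := hanti (k + 1) (by omega) (by omega)
      simp only [hi₀, zero_add]
      linarith
    · simp only [hi₀, zero_add]
      exact inv_mul_cancel₀ (by positivity)
    · have h3 : lam ((i₀ : ℕ) + 1) ^ 2 * (lam 1 - lam 2)⁻¹ * β = B := by
        simp only [hi₀, zero_add, hBdef, OnlinePCA.betaHat]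
      simp only [h3]
      nlinarith
  have hμ := OnlinePCA.hasMoments_of_isotropic hR.isHermitian hRS hS.isHermitian
    (Λ := fun i : Fin d => lam (i + 1)) hb hZ
  obtain ⟨A, hA, hPA, hint⟩ := OnlinePCA.exists_event hd hμ hstep (by simp [hi₀]) hX hu0
    (fun n => (hid n).map_eq) hlaw.map_eq hind hind0 hu
    (OnlinePCA.inner_sq_eq_of_eigenvector hS.isHermitian hb (i₀ := i₀) (fun k hk => by
      have h2 : (k : ℕ) ≠ 0 := fun h => hk (Fin.ext h)
      have := hanti (k + 1) (by omega) (by omega)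
      simp only [hi₀, zero_add]
      linarith) hu (by simpa [hi₀] using hSu)) hδ hδ2 hBd
  refine ⟨A, hA, ?_, fun n hn2 hn3 => (hint n hn2 hn3).trans (ENNReal.ofReal_le_ofReal ?_)⟩
  · have h1 : P.real Aᶜ ≤ 2 * δ := ENNReal.toReal_le_of_le_ofReal (by positivity) hPA
    rw [probReal_compl_eq_one_sub hA] at h1
    linarith
  · have hpow : 0 ≤ (1 - β * (lam 1 - lam 2)) ^ (2 * n) := by
      rw [pow_mul]
      positivity
    have hfirst : 0 ≤ 256 * δ ^ (-4 : ℤ) * (d : ℝ) ^ 2 *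
        (1 - β * (lam 1 - lam 2)) ^ (2 * n) := by positivity
    have hBp : 0 ≤ B ^ (0.5 - 4 * ε : ℝ) := by positivity
    have hsum : 4 * ∑ k ∈ Finset.univ.erase i₀,
        OnlinePCA.noiseLevel (fun i : Fin d => lam (i + 1)) i₀ β k =
        256 * ∑ k ∈ Finset.Icc 2 d, lam 1 * lam k / (lam 1 - lam k) * β := by
      rw [← OnlinePCA.sum_erase_eq_sum_Icc hd0
        (fun k => lam 1 * lam k / (lam 1 - lam k) * β), Finset.mul_sum, Finset.mul_sum]
      refine Finset.sum_congr rfl fun k _ => ?_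
      simp only [OnlinePCA.noiseLevel, hi₀, zero_add]
      ring
    -- Since λ₁²β/(λ₁ - λ₂) = B, the k = 2 summand alone is B · B^{0.5-4ε}, which is at least
    -- B^{3/2} for B < 1.
    have hbonus : B ^ (3 / 2 : ℝ) ≤ ∑ k ∈ Finset.Icc 2 d,
        lam 1 ^ 2 * B ^ (0.5 - 4 * ε : ℝ) / (lam 1 - lam k) * β := by
      have h1 : B ^ (3 / 2 : ℝ) ≤ B * B ^ (0.5 - 4 * ε : ℝ) := by
        rw [show (3 / 2 : ℝ) = 1 + 0.5 by norm_num, Real.rpow_add hB0, Real.rpow_one]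
        gcongr ?_ * ?_
        exact Real.rpow_le_rpow_of_exponent_ge hB0 hBlt.le (by linarith)
      have h2 : B * B ^ (0.5 - 4 * ε : ℝ) =
          lam 1 ^ 2 * B ^ (0.5 - 4 * ε : ℝ) / (lam 1 - lam 2) * β := by
        rw [show B = lam 1 ^ 2 * (lam 1 - lam 2)⁻¹ * β from rfl]
        ring
      rw [h2] at h1
      refine h1.trans (Finset.single_le_sum
        (f := fun k => lam 1 ^ 2 * B ^ (0.5 - 4 * ε : ℝ) / (lam 1 - lam k) * β)
        (fun k hk => ?_) (Finset.mem_Icc.2 ⟨le_rfl, hd⟩))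
      have := (hterm k hk).1
      positivity
    have hsplit : ∑ k ∈ Finset.Icc 2 d,
        (lam 1 * lam k + lam 1 ^ 2 * B ^ (0.5 - 4 * ε : ℝ)) / (lam 1 - lam k) * β =
        ∑ k ∈ Finset.Icc 2 d, lam 1 * lam k / (lam 1 - lam k) * β +
        ∑ k ∈ Finset.Icc 2 d, lam 1 ^ 2 * B ^ (0.5 - 4 * ε : ℝ) / (lam 1 - lam k) * β := by
      rw [← Finset.sum_add_distrib]
      refine Finset.sum_congr rfl fun k _ => ?_
      rw [add_div, add_mul]
    have hB32 : 0 ≤ B ^ (3 / 2 : ℝ) := by positivity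
    rw [hsum, hsplit]
    linarith
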